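/- Let $A=(a_{ij})_{i,j\in\mathcal I}$ be a generalized Cartan matrix with $\mathcal I$ finite, and let $\mathfrak g=\mathfrak g(A)$ be the Kac--Moody algebra over $\mathbb C$ attached to a (minimal) realization $(\mathfrak h,\Pi=\{\alpha_i\}_{i\in\mathcal I},\Pi^\vee=\{\alpha_i^\vee\}_{i\in\mathcal I})$ of $A$, with Chevalley generators $e_i,f_i$; that is, $\mathfrak g$ is the quotient of the Lie algebra generated by $\mathfrak h,e_i,f_i$ modulo the Chevalley and Serre relations by its largest ideal intersecting $\mathfrak h$ trivially. For a $\mathfrak g$-module $V$ and $\mu\in\mathfrak h^*$ put $V_\mu=\{v\in V: hv=\mu(h)v\ \ \forall h\in\mathfrak h\}$ and $\operatorname{wt}V=\{\mu\in\mathfrak h^*: V_\mu\neq 0\}$. For $x,y\in\mathfrak h^*$ write $x\prec y$ if $y-x\in\mathbb Z_{\ge 0}\Pi$, and let $\operatorname{ht}\big(\sum_i c_i\alpha_i\big)=\sum_i c_i$. For $\lambda\in\mathfrak h^*$ let $J_\lambda=\{i\in\mathcal I:\lambda(\alpha_i^\vee)\in\mathbb Z_{\ge 0}\}$; let $M(\lambda)$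 be the Verma module over $\mathfrak g$ with highest weight vector $m_\lambda$ of weight $\lambda$, and for $J\subseteq J_\lambda$ (possibly empty) let $$M(\lambda,J)=M(\lambda)\Big/\sum_{j\in J}U(\mathfrak n^-)f_j^{\lambda(\alpha_j^\vee)+1}m_\lambda$$ be the parabolic Verma module, where $\mathfrak n^-$ is the subalgebra of $\mathfrak g$ generated by the $f_i$. Let $V$ be a $\mathfrak g$-module such that either (D1) $V=\mathfrak g$ is the adjoint representation, or (D2) $V$ is an arbitrary submodule of $M(\lambda,J)$ for some $\lambda\in\mathfrak h^*$ and $J\subseteq J_\lambda$. Let $\mu_0,\mu\in\operatorname{wt}V$ with $\mu_0\prec\mu$ and $\mu_0\neq\mu$, and put $n=\operatorname{ht}(\mu-\mu_0)$. Then there are weights $\mu_1,\dots,\mu_n\in\operatorname{wt}V$ with $\mu_n=\mu$ and $\mu_i-\mu_{i-1}\in\Pi$ for all $1\le i\le n$; in particular $\mu_0\prec\mu_1\prec\cdots\prec\mu_n=\mu$. -/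

import Mathlib

noncomputable section

namespace KacMoody

/-- Generalized Cartan matrices. -/
structure IsGCM {I : Type*} (A : Matrix I I ℤ) : Prop where
  diag : ∀ i, A i i = 2
  nonpos : ∀ i j, i ≠ j → A i j ≤ 0
  zero_symm : ∀ i j, A i j = 0 → A j i = 0

/-- A (minimal) realization `(𝔥, Π, Π^∨)` of the matrix `A` over `ℂ`:
`Π = {α_i} ⊂ 𝔥*` and `Π^∨ = {α_i^∨} ⊂ 𝔥` are linearly independent, `⟨α_j, α_i^∨⟩ = A i j`, and
`dim 𝔥 = 2 |I| - rank A`. -/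
structure Realization {I : Type*} [Fintype I] (A : Matrix I I ℤ)
    (𝔥 : Type*) [AddCommGroup 𝔥] [Module ℂ 𝔥] where
  /-- the simple roots `α_i` -/
  root : I → Module.Dual ℂ 𝔥
  /-- the simple coroots `α_i^∨` -/
  coroot : I → 𝔥
  linearIndependent_root : LinearIndependent ℂ root
  linearIndependent_coroot : LinearIndependent ℂ coroot
  root_coroot : ∀ i j, root j (coroot i) = (A i j : ℂ)
  finiteDimensional : Module.Finite ℂ 𝔥
  finrank_add_rank :
    Module.finrank ℂ 𝔥 + (A.map (Int.cast : ℤ → ℂ)).rank = 2 * Fintype.card I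

/-- The generators `e_i`, `f_i` (`i ∈ I`) and `h ∈ 𝔥`. -/
inductive Gen (I 𝔥 : Type*)
  | e : I → Gen I 𝔥
  | f : I → Gen I 𝔥
  | h : 𝔥 → Gen I 𝔥

variable {I : Type*} [Fintype I] {A : Matrix I I ℤ} {𝔥 : Type*} [AddCommGroup 𝔥] [Module ℂ 𝔥]

/-- The free Lie algebra on the generators. -/
abbrev Free (I 𝔥 : Type*) := FreeLieAlgebra ℂ (Gen I 𝔥)

/-- The generator `e_i` of the free Lie algebra. -/
abbrev freeE (𝔥 : Type*) {I : Type*} (i : I) : Free I 𝔥 := FreeLieAlgebra.of ℂ (Gen.e i)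

/-- The generator `f_i` of the free Lie algebra. -/
abbrev freeF (𝔥 : Type*) {I : Type*} (i : I) : Free I 𝔥 := FreeLieAlgebra.of ℂ (Gen.f i)

/-- The generator of the free Lie algebra given by `x ∈ 𝔥`. -/
abbrev freeH (I : Type*) {𝔥 : Type*} (x : 𝔥) : Free I 𝔥 := FreeLieAlgebra.of ℂ (Gen.h x)

/-- The defining relators: linearity and commutativity of `𝔥`, the Chevalley relations, and the
relations `(ad e_i)^{1 - a_ij} e_j = 0 = (ad f_i)^{1 - a_ij} f_j` for `i ≠ j`. -/
inductive Relator (R : Realization A 𝔥) : Free I 𝔥 → Prop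
  | add (x y : 𝔥) : Relator R (freeH I (x + y) - (freeH I x + freeH I y))
  | smul (c : ℂ) (x : 𝔥) : Relator R (freeH I (c • x) - c • freeH I x)
  | hh (x y : 𝔥) : Relator R ⁅freeH I x, freeH I y⁆
  | he (x : 𝔥) (i : I) : Relator R (⁅freeH I x, freeE 𝔥 i⁆ - R.root i x • freeE 𝔥 i)
  | hf (x : 𝔥) (i : I) : Relator R (⁅freeH I x, freeF 𝔥 i⁆ + R.root i x • freeF 𝔥 i)
  | ef (i : I) : Relator R (⁅freeE 𝔥 i, freeF 𝔥 i⁆ - freeH I (R.coroot i))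
  | ef_ne (i j : I) : i ≠ j → Relator R ⁅freeE 𝔥 i, freeF 𝔥 j⁆
  | serreE (i j : I) : i ≠ j →
      Relator R (((LieAlgebra.ad ℂ (Free I 𝔥) (freeE 𝔥 i)) ^ (1 - A i j).toNat) (freeE 𝔥 j))
  | serreF (i j : I) : i ≠ j →
      Relator R (((LieAlgebra.ad ℂ (Free I 𝔥) (freeF 𝔥 i)) ^ (1 - A i j).toNat) (freeF 𝔥 j))

/-- The ideal of the free Lie algebra generated by the relators. -/
def relIdeal (R : Realization A 𝔥) : LieIdeal ℂ (Free I 𝔥) :=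
  LieSubmodule.lieSpan ℂ (Free I 𝔥) {x | Relator R x}

/-- The Lie algebra `𝔤̄(A)` presented by the generators and relators above. -/
abbrev SerreAlgebra (R : Realization A 𝔥) := Free I 𝔥 ⧸ relIdeal R

/-- The projection from the free Lie algebra onto `𝔤̄(A)`. -/
def toSerre (R : Realization A 𝔥) (x : Free I 𝔥) : SerreAlgebra R :=
  LieSubmodule.Quotient.mk x

/-- The largest ideal of `𝔤̄(A)` intersecting (the image of) `𝔥` trivially: the sum of all the
ideals with this property. -/
def radIdeal (R : Realization A 𝔥) : LieIdeal ℂ (SerreAlgebra R) :=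
  sSup {K | ∀ x : 𝔥, toSerre R (freeH I x) ∈ K → toSerre R (freeH I x) = 0}

/-- The Kac--Moody algebra `𝔤(A)`. -/
abbrev KMAlgebra (R : Realization A 𝔥) := SerreAlgebra R ⧸ radIdeal R

/-- The projection from the free Lie algebra onto `𝔤(A)`. -/
def mk (R : Realization A 𝔥) (x : Free I 𝔥) : KMAlgebra R :=
  LieSubmodule.Quotient.mk (toSerre R x)

/-- The Chevalley generator `e_i` of `𝔤(A)`. -/
def e (R : Realization A 𝔥) (i : I) : KMAlgebra R := mk R (freeE 𝔥 i)

/-- The Chevalley generator `f_i` of `𝔤(A)`. -/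
def f (R : Realization A 𝔥) (i : I) : KMAlgebra R := mk R (freeF 𝔥 i)

/-- The element of `𝔤(A)` given by `x ∈ 𝔥`. -/
def h (R : Realization A 𝔥) (x : 𝔥) : KMAlgebra R := mk R (freeH I x)

section Weights

variable (R : Realization A 𝔥) (M : Type*) [AddCommGroup M] [Module ℂ M]
  [LieRingModule (KMAlgebra R) M] [LieModule ℂ (KMAlgebra R) M]

/-- The weight space `M_μ = {v ∈ M | h v = μ(h) v for all h ∈ 𝔥}`. -/
def weightSpace (μ : Module.Dual ℂ 𝔥) : Submodule ℂ M where
  carrier := {v | ∀ x : 𝔥, ⁅h R x, v⁆ = μ x • v}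
  zero_mem' := by intro x; simp
  add_mem' := by
    intro v w hv hw x
    rw [lie_add, hv x, hw x, smul_add]
  smul_mem' := by
    intro c v hv x
    rw [lie_smul, hv x, smul_comm]

/-- The set `wt M` of weights of `M`. -/
def wt : Set (Module.Dual ℂ 𝔥) := {μ | weightSpace R M μ ≠ ⊥}

end Weights

section Verma

variable (R : Realization A 𝔥) (lam : Module.Dual ℂ 𝔥)

/-- The universal enveloping algebra `U(𝔤)`. -/
abbrev U := UniversalEnvelopingAlgebra ℂ (KMAlgebra R)

/-- The left ideal of `U(𝔤)` generated by `𝔫⁺` (equivalently, by the `e_i`) and the elements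
`h - λ(h)`, `h ∈ 𝔥`. -/
def vermaIdeal : Submodule (U R) (U R) :=
  Submodule.span (U R)
    (Set.range (fun i : I => UniversalEnvelopingAlgebra.ι ℂ (e R i)) ∪
      Set.range (fun x : 𝔥 =>
        UniversalEnvelopingAlgebra.ι ℂ (h R x) - algebraMap ℂ (U R) (lam x)))

/-- The Verma module `M(λ)`. -/
def Verma := U R ⧸ vermaIdeal R lam

instance : AddCommGroup (Verma R lam) :=
  inferInstanceAs (AddCommGroup (U R ⧸ vermaIdeal R lam))

instance : Module (U R) (Verma R lam) :=
  inferInstanceAs (Module (U R) (U R ⧸ vermaIdeal R lam))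

instance : Module ℂ (Verma R lam) :=
  inferInstanceAs (Module ℂ (U R ⧸ vermaIdeal R lam))

instance : IsScalarTower ℂ (U R) (Verma R lam) :=
  inferInstanceAs (IsScalarTower ℂ (U R) (U R ⧸ vermaIdeal R lam))

attribute [local instance] LieRing.ofAssociativeRing in
/-- `𝔤` acts on `M(λ)` through `𝔤 → U(𝔤)`. -/
instance : LieRingModule (KMAlgebra R) (Verma R lam) :=
  letI : LieRingModule (U R) (Verma R lam) := LieRingModule.ofAssociativeModule
  LieRingModule.compLieHom (Verma R lam)
    (UniversalEnvelopingAlgebra.ι ℂ : KMAlgebra R →ₗ⁅ℂ⁆ U R)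

attribute [local instance] LieRing.ofAssociativeRing in
instance : LieModule ℂ (KMAlgebra R) (Verma R lam) :=
  letI : LieRingModule (U R) (Verma R lam) := LieRingModule.ofAssociativeModule
  haveI : LieModule ℂ (U R) (Verma R lam) := LieModule.ofAssociativeModule
  LieModule.compLieHom (Verma R lam)
    (UniversalEnvelopingAlgebra.ι ℂ : KMAlgebra R →ₗ⁅ℂ⁆ U R)

/-- The highest weight vector `m_λ` of `M(λ)`, the class of `1`. -/
def vermaVec : Verma R lam := (vermaIdeal R lam).mkQ 1

/-- `J_λ = {i ∈ I | ⟨λ, α_i^∨⟩ ∈ ℤ_{≥ 0}}`. -/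
def Jset : Set I := {i | ∃ n : ℕ, lam (R.coroot i) = n}

/-- The `𝔤`-submodule of `M(λ)` generated by the vectors `f_j^{⟨λ, α_j^∨⟩ + 1} m_λ`, `j ∈ J`.
(These vectors are killed by every `e_i`, so it equals `∑_{j ∈ J} U(𝔫⁻) f_j^{⟨λ, α_j^∨⟩ + 1} m_λ`.) -/
def integrabilitySubmodule (J : Set I) : LieSubmodule ℂ (KMAlgebra R) (Verma R lam) :=
  LieSubmodule.lieSpan ℂ (KMAlgebra R)
    {v | ∃ j ∈ J, ∃ n : ℕ, lam (R.coroot j) = n ∧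
      v = ((LieModule.toEnd ℂ (KMAlgebra R) (Verma R lam) (f R j)) ^ (n + 1)) (vermaVec R lam)}

/-- The parabolic Verma module `M(λ, J)` (for `J ⊆ J_λ`). -/
abbrev ParabolicVerma (J : Set I) := Verma R lam ⧸ integrabilitySubmodule R lam J

end Verma

section Order

variable (R : Realization A 𝔥)

/-- `μ₀ ≺ μ` iff `μ - μ₀ ∈ ℤ_{≥ 0} Π`. -/
def Prec (μ₀ μ : Module.Dual ℂ 𝔥) : Prop := μ - μ₀ ∈ AddSubmonoid.closure (Set.range R.root)

open Classical in
/-- The height `∑ c_i` of `∑ c_i α_i ∈ ℂΠ` (and `0` outside the span `ℂΠ`). -/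
def height (x : Module.Dual ℂ 𝔥) : ℂ :=
  if hx : x ∈ Submodule.span ℂ (Set.range R.root) then
    ∑ i, R.linearIndependent_root.repr ⟨x, hx⟩ i
  else 0

/-- Some weights `μ₀ = ν 0 ≺ ν 1 ≺ ⋯ ≺ ν n = μ` in the set `S`, with `n = ht(μ - μ₀)`, have all
the consecutive differences `ν (k + 1) - ν k` in `Π`. -/
def HasSimpleChain (S : Set (Module.Dual ℂ 𝔥)) (μ₀ μ : Module.Dual ℂ 𝔥) : Prop :=
  ∃ (n : ℕ) (ν : Fin (n + 1) → Module.Dual ℂ 𝔥),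
    (n : ℂ) = height R (μ - μ₀) ∧ ν 0 = μ₀ ∧ ν (Fin.last n) = μ ∧ (∀ k, ν k ∈ S) ∧
      ∀ k : Fin n, ν k.succ - ν k.castSucc ∈ Set.range R.root

end Order

end KacMoody

end

/-! Everything reduces to one step (`HasStep`): if μ₀ and μ = μ₀ + ∑ c_k α_k are weights with c ≥ 0,
c ≠ 0, then for some i with c_i > 0 either μ₀ + α_i or μ - α_i is a weight. Induction on the height
then gives the chain, extended at one end or the other.

Suppose no such step exists. Then a weight vector v₀ of weight μ₀ is killed by e_i, and a weight
vector v of weight μ by f_i, for every i in supp c. Where e_i and f_i act locally nilpotently,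
𝔰𝔩₂-theory gives μ₀(α_i^∨) ≥ 0 ≥ μ(α_i^∨), so Ac ≤ 0 on supp c. Comparing c with a second
nonnegative vector d, the indices of supp c minimizing d_i / c_i form a nonempty set Z that is
orthogonal to the rest of supp(c + d) (`IsGCM.exists_orthogonal_subset`).

For the adjoint representation the involution e_i ↔ f_i allows μ to be a positive root. If μ₀ ≤ 0,
an f_i not killing v already gives a step. If μ₀ ≥ 0, take d to be its coefficient vector: the
support of μ is connected, hence contained in Z, so all f_i with i in supp μ kill v, contradicting
`exists_lie_f_ne_zero`.

For a submodule of M(λ, J), f_i is injective when i ∉ J, so supp c ⊆ J. Take d to be the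
coefficients of λ - μ. Then also λ(α_z^∨) = 0 on Z, so f_z kills the highest weight vector m and
commutes with the f_k, k ∉ Z, that occur. Every word in the f_k of weight λ - μ₀ therefore kills m,
contradicting that μ₀ is a weight.

Injectivity of f_i for i ∉ J (`eq_zero_of_lie_f_eq_zero`) is obtained without the
Poincaré–Birkhoff–Witt theorem. There is a highest weight module N of highest weight 0, generated by
n, with f_i n ≠ 0 and f_k n = 0 for k ≠ i. The map M(λ, J) → M(λ, J) ⊗ N sending m to m ⊗ n,
followed by the coefficient of f_i n, is a locally nilpotent operator D with [D, f_i] = 1. The bulk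
of the preparation shows that N really is a module over 𝔤(A): the Serre elements and the radical act
on it by zero. -/

noncomputable section

namespace KacMoody

open TensorProduct

attribute [local instance] LieRing.ofAssociativeRing

/-! ### Simultaneous eigenspaces and their independence. -/

section WeightVectors

variable {𝔥 V : Type*} [AddCommGroup 𝔥] [Module ℂ 𝔥] [AddCommGroup V] [Module ℂ V]

/-- The simultaneous eigenspace of a family of operators indexed by `𝔥`. -/
def eigen (T : 𝔥 → Module.End ℂ V) (μ : Module.Dual ℂ 𝔥) : Submodule ℂ V where
  carrier := {v | ∀ x, T x v = μ x • v}
  zero_mem' := by intro x; simp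
  add_mem' := by
    intro v w hv hw x
    rw [map_add, hv x, hw x, smul_add]
  smul_mem' := by
    intro c v hv x
    rw [map_smul, hv x, smul_comm]

/-- A subspace stable under a family of operators contains the components of its elements. -/
theorem mem_of_sum_mem (T : 𝔥 → Module.End ℂ V) (W : Submodule ℂ V)
    (hW : ∀ x, ∀ w ∈ W, T x w ∈ W) (s : Finset (Module.Dual ℂ 𝔥)) :
    ∀ v : Module.Dual ℂ 𝔥 → V, (∀ μ ∈ s, v μ ∈ eigen T μ) → ∑ μ ∈ s, v μ ∈ W →
      ∀ μ ∈ s, v μ ∈ W := by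
  classical
  induction s using Finset.induction_on with
  | empty => simp
  | insert ν s hν ih =>
    intro v hv hsum
    have key : ∀ μ ∈ s, v μ ∈ W := by
      intro μ hμ
      obtain ⟨x, hx⟩ : ∃ x, μ x ≠ ν x := by
        by_contra! h
        exact hν (LinearMap.ext h ▸ hμ)
      -- The operator `T x - ν x` removes the ν-component and scales the others; x was chosen so
      -- that the factor at μ is nonzero.
      have h1 : ∑ κ ∈ s, (κ x - ν x) • v κ ∈ W := by
        have h2 : ∑ κ ∈ s, (κ x - ν x) • v κ
            = T x (∑ κ ∈ insert ν s, v κ) - ν x • ∑ κ ∈ insert ν s, v κ := by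
          rw [map_sum, Finset.smul_sum, ← Finset.sum_sub_distrib, Finset.sum_insert hν,
            hv ν (Finset.mem_insert_self _ _) x, sub_self, zero_add]
          refine Finset.sum_congr rfl fun κ hκ => ?_
          rw [hv κ (Finset.mem_insert_of_mem hκ) x, sub_smul]
        rw [h2]
        exact W.sub_mem (hW x _ hsum) (W.smul_mem _ hsum)
      have h3 := ih (fun κ => (κ x - ν x) • v κ)
        (fun κ hκ => (eigen T κ).smul_mem _ (hv κ (Finset.mem_insert_of_mem hκ))) h1 μ hμ
      exact (W.smul_mem_iff (sub_ne_zero.2 hx)).1 h3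
    intro μ hμ
    rcases Finset.mem_insert.1 hμ with rfl | hμ
    · rw [Finset.sum_insert hν] at hsum
      exact (W.add_mem_iff_left (W.sum_mem key)).1 hsum
    · exact key μ hμ

/-- The form used later: with W an ideal it extracts one weight component of an element, and with W
= ⊥ it says that weight spaces are independent. -/
theorem mem_of_add_mem {T : 𝔥 → Module.End ℂ V} {W : Submodule ℂ V}
    (hW : ∀ x, ∀ w ∈ W, T x w ∈ W) {μ : Module.Dual ℂ 𝔥} {y z : V} (hy : y ∈ eigen T μ)
    (hz : z ∈ ⨆ ν : {ν // ν ≠ μ}, eigen T ν.1) (hyz : y + z ∈ W) : y ∈ W := by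
  classical
  obtain ⟨g, hg, rfl⟩ := (Submodule.mem_iSup_iff_exists_finsupp _ _).1 hz
  let s : Finset (Module.Dual ℂ 𝔥) := g.support.map (Function.Embedding.subtype _)
  let v : Module.Dual ℂ 𝔥 → V := fun ν => if h : ν ≠ μ then g ⟨ν, h⟩ else y
  have hs : μ ∉ s := by simp [s]
  have hvμ : v μ = y := by simp [v]
  have hsum : ∑ ν ∈ s, v ν = g.sum fun _ x => x := by
    rw [Finset.sum_map]
    refine Finset.sum_congr rfl fun ν _ => ?_
    simp [v, ν.2]
  have := mem_of_sum_mem T W hW (insert μ s) v ?_ ?_ μ (Finset.mem_insert_self _ _)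
  · rwa [hvμ] at this
  · intro ν hν
    by_cases h : ν = μ
    · subst h
      rwa [hvμ]
    · have : v ν = g ⟨ν, h⟩ := by simp [v, h]
      rw [this]
      exact hg ⟨ν, h⟩
  · rw [Finset.sum_insert hs, hvμ, hsum]
    exact hyz

theorem eq_zero_of_mem_eigen {T : 𝔥 → Module.End ℂ V} {μ : Module.Dual ℂ 𝔥} {y : V}
    (hy : y ∈ eigen T μ) (hz : y ∈ ⨆ ν : {ν // ν ≠ μ}, eigen T ν.1) : y = 0 := by
  have := mem_of_add_mem (W := ⊥) (T := T) (by simp) hy (neg_mem hz) (by simp)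
  simpa using this

theorem mem_iSup_eigen {V : Type*} [AddCommGroup V] [Module ℂ V] {T : 𝔥 → Module.End ℂ V}
    {μ ν : Module.Dual ℂ 𝔥} {x : V} (hx : x ∈ eigen T ν) (h : ν ≠ μ) :
    x ∈ ⨆ ν : {ν // ν ≠ μ}, eigen T ν.1 :=
  Submodule.mem_iSup_of_mem (⟨ν, h⟩ : {ν // ν ≠ μ}) hx

/-- In a space spanned by weight vectors, every weight is the weight of a nonzero one of these. -/
theorem exists_of_span {T : 𝔥 → Module.End ℂ V} {ι : Type*} {b : ι → V}
    {wt : ι → Module.Dual ℂ 𝔥} (hb : ∀ s, b s ∈ eigen T (wt s)) {μ : Module.Dual ℂ 𝔥} {v : V}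
    (hv : v ∈ eigen T μ) (hv0 : v ≠ 0) (hspan : v ∈ Submodule.span ℂ (Set.range b)) :
    ∃ s, wt s = μ ∧ b s ≠ 0 := by
  by_contra! h
  refine hv0 (eq_zero_of_mem_eigen hv ?_)
  refine Submodule.span_le.2 ?_ hspan
  rintro _ ⟨s, rfl⟩
  by_cases hs : wt s = μ
  · rw [h s hs]
    exact zero_mem _
  · exact Submodule.mem_iSup_of_mem (⟨wt s, hs⟩ : {ν // ν ≠ μ}) (hb s)

end WeightVectors

/-! ### Words in the index set and the free module on them. -/

section Words

variable {I : Type*}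

/-- The multiplicities of the letters in a word. -/
def cnt (w : List I) (k : I) : ℤ :=
  open Classical in (w.count k : ℤ)

theorem cnt_nonneg (w : List I) (k : I) : 0 ≤ cnt w k := by
  simp [cnt]

@[simp] theorem cnt_nil : cnt ([] : List I) = 0 := by
  ext k; simp [cnt]

theorem cnt_cons_of_ne {j k : I} (h : j ≠ k) (w : List I) : cnt (j :: w) k = cnt w k := by
  classical
  simp only [cnt]
  rw [List.count_cons_of_ne h]

theorem cnt_cons_self (k : I) (w : List I) : cnt (k :: w) k = cnt w k + 1 := by
  simp [cnt]

theorem cnt_cons [DecidableEq I] (k : I) (w : List I) : cnt (k :: w) = Pi.single k 1 + cnt w := by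
  ext j
  by_cases h : k = j
  · subst h
    simp [cnt_cons_self, add_comm]
  · simp [cnt_cons_of_ne h, Ne.symm h]

theorem cnt_pos_iff {w : List I} {k : I} : 0 < cnt w k ↔ k ∈ w := by
  classical
  simp only [cnt, Nat.cast_pos]
  exact List.count_pos_iff

/-- The action of `f_k` on the free module on the words. -/
def freeModF (k : I) : Module.End ℂ (List I →₀ ℂ) := Finsupp.lmapDomain ℂ ℂ (List.cons k)

@[simp] theorem freeModF_single (k : I) (w : List I) (a : ℂ) :
    freeModF k (Finsupp.single w a) = Finsupp.single (k :: w) a := by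
  simp [freeModF]

theorem freeModF_apply_nil (k : I) (v : List I →₀ ℂ) : freeModF k v [] = 0 :=
  Finsupp.mapDomain_of_notMem_range _ _ (by simp)

theorem freeModF_apply_cons (k : I) (v : List I →₀ ℂ) (w : List I) :
    freeModF k v (k :: w) = v w :=
  Finsupp.mapDomain_apply (List.cons_injective) _ _

theorem freeModF_apply_cons_ne {k j : I} (hkj : k ≠ j) (v : List I →₀ ℂ) (w : List I) :
    freeModF k v (j :: w) = 0 :=
  Finsupp.mapDomain_of_notMem_range _ _ (by simp [hkj])

end Words

variable {I : Type*} [Fintype I] {A : Matrix I I ℤ} {𝔥 : Type*} [AddCommGroup 𝔥] [Module ℂ 𝔥]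

/-! ### Chevalley relations, and highest weight vectors. -/

section Chevalley

/-- Elements of a Lie algebra satisfying the Chevalley relations. -/
structure Chevalley (R : Realization A 𝔥) (𝔏 : Type*) [LieRing 𝔏] [LieAlgebra ℂ 𝔏] where
  /-- the elements `e_i` -/
  e : I → 𝔏
  /-- the elements `f_i` -/
  f : I → 𝔏
  /-- the map from `𝔥` -/
  h : 𝔥 →ₗ[ℂ] 𝔏
  lie_h_h : ∀ x y, ⁅h x, h y⁆ = 0
  lie_h_e : ∀ x i, ⁅h x, e i⁆ = R.root i x • e i
  lie_h_f : ∀ x i, ⁅h x, f i⁆ = -(R.root i x • f i)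
  lie_e_f : ∀ i, ⁅e i, f i⁆ = h (R.coroot i)
  lie_e_f_ne : ∀ i j, i ≠ j → ⁅e i, f j⁆ = 0

variable {R : Realization A 𝔥} {𝔏 : Type*} [LieRing 𝔏] [LieAlgebra ℂ 𝔏]
  {𝔏' : Type*} [LieRing 𝔏'] [LieAlgebra ℂ 𝔏']

/-- Exchanging the roles of the `e_i` and the `f_i`. -/
def Chevalley.swap (c : Chevalley R 𝔏) : Chevalley R 𝔏 where
  e := c.f
  f := c.e
  -- The sign is forced by ⁅f_i, e_i⁆ = -α_i^∨; it also makes f_i raise the new weight by α_i.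
  h := -c.h
  lie_h_h x y := by simp [c.lie_h_h]
  lie_h_e x i := by simp [c.lie_h_f]
  lie_h_f x i := by simp [c.lie_h_e]
  lie_e_f i := by rw [← lie_skew, c.lie_e_f]; rfl
  lie_e_f_ne i j hij := by rw [← lie_skew, c.lie_e_f_ne j i hij.symm, neg_zero]

/-- The image under a homomorphism of Lie algebras. -/
def Chevalley.map (c : Chevalley R 𝔏) (φ : 𝔏 →ₗ⁅ℂ⁆ 𝔏') : Chevalley R 𝔏' where
  e i := φ (c.e i)
  f i := φ (c.f i)
  h := (φ : 𝔏 →ₗ[ℂ] 𝔏') ∘ₗ c.h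
  lie_h_h x y := by simp [← LieHom.map_lie, c.lie_h_h]
  lie_h_e x i := by simp [← LieHom.map_lie, c.lie_h_e]
  lie_h_f x i := by simp [← LieHom.map_lie, c.lie_h_f]
  lie_e_f i := by simp [← LieHom.map_lie, c.lie_e_f]
  lie_e_f_ne i j hij := by simp [← LieHom.map_lie, c.lie_e_f_ne i j hij]

/-- The elements of `𝔏` acting on `𝔏` by the adjoint representation. -/
def Chevalley.ad (c : Chevalley R 𝔏) : Chevalley R (Module.End ℂ 𝔏) :=
  c.map (LieAlgebra.ad ℂ 𝔏)

/-- `𝔏` is generated by the Chevalley elements. -/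
def Chevalley.Generates (c : Chevalley R 𝔏) : Prop :=
  ∀ K : LieSubalgebra ℂ 𝔏, (∀ i, c.e i ∈ K) → (∀ i, c.f i ∈ K) → (∀ x, c.h x ∈ K) → K = ⊤

theorem Chevalley.Generates.swap {c : Chevalley R 𝔏} (hc : c.Generates) : c.swap.Generates :=
  fun K he hf hh => hc K hf he fun x => by simpa [Chevalley.swap] using hh x

/-- The weight `∑ α_k` of a word in the index set. -/
def wordWt (R : Realization A 𝔥) (w : List I) : Module.Dual ℂ 𝔥 := (w.map R.root).sum

@[simp] theorem wordWt_nil : wordWt R [] = 0 := rfl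

@[simp] theorem wordWt_cons (k : I) (w : List I) : wordWt R (k :: w) = R.root k + wordWt R w := by
  simp [wordWt]

section Module

variable {V : Type*} [AddCommGroup V] [Module ℂ V] (c : Chevalley R (Module.End ℂ V))

/-- The result of applying `f_k`, for the letters `k` of a word, to a vector. -/
def Chevalley.word (w : List I) (m : V) : V := w.foldr (fun k v => c.f k v) m

@[simp] theorem Chevalley.word_nil (m : V) : c.word [] m = m := rfl

@[simp] theorem Chevalley.word_cons (k : I) (w : List I) (m : V) :
    c.word (k :: w) m = c.f k (c.word w m) := rfl

/-- The weight spaces of the action. -/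
abbrev Chevalley.wtSpace (μ : Module.Dual ℂ 𝔥) : Submodule ℂ V := eigen (fun x => c.h x) μ

variable {c}

theorem Chevalley.h_f (x : 𝔥) (k : I) (v : V) :
    c.h x (c.f k v) = c.f k (c.h x v) - R.root k x • c.f k v := by
  have := LinearMap.congr_fun (c.lie_h_f x k) v
  simp only [Ring.lie_def, LinearMap.sub_apply, Module.End.mul_apply, LinearMap.neg_apply,
    LinearMap.smul_apply] at this
  rw [sub_eq_iff_eq_add] at this
  rw [this]; abel

theorem Chevalley.h_e (x : 𝔥) (k : I) (v : V) :
    c.h x (c.e k v) = c.e k (c.h x v) + R.root k x • c.e k v := by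
  have := LinearMap.congr_fun (c.lie_h_e x k) v
  simp only [Ring.lie_def, LinearMap.sub_apply, Module.End.mul_apply,
    LinearMap.smul_apply] at this
  rw [sub_eq_iff_eq_add] at this
  rw [this]; abel

theorem Chevalley.e_f (k : I) (v : V) :
    c.e k (c.f k v) = c.f k (c.e k v) + c.h (R.coroot k) v := by
  have := LinearMap.congr_fun (c.lie_e_f k) v
  simp only [Ring.lie_def, LinearMap.sub_apply, Module.End.mul_apply] at this
  rw [sub_eq_iff_eq_add] at this
  rw [this]; abel

theorem Chevalley.e_f_ne {k j : I} (hkj : k ≠ j) (v : V) :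
    c.e k (c.f j v) = c.f j (c.e k v) := by
  have := LinearMap.congr_fun (c.lie_e_f_ne k j hkj) v
  simpa only [Ring.lie_def, LinearMap.sub_apply, Module.End.mul_apply, LinearMap.zero_apply,
    sub_eq_zero] using this

theorem Chevalley.f_mem_wtSpace {μ : Module.Dual ℂ 𝔥} {v : V} (hv : v ∈ c.wtSpace μ) (k : I) :
    c.f k v ∈ c.wtSpace (μ - R.root k) := by
  intro x
  simp [Chevalley.h_f, hv x, sub_smul]

theorem Chevalley.e_mem_wtSpace {μ : Module.Dual ℂ 𝔥} {v : V} (hv : v ∈ c.wtSpace μ) (k : I) :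
    c.e k v ∈ c.wtSpace (μ + R.root k) := by
  intro x
  simp [Chevalley.h_e, hv x, add_smul]

theorem Chevalley.word_mem_wtSpace {μ : Module.Dual ℂ 𝔥} {v : V} (hv : v ∈ c.wtSpace μ)
    (w : List I) : c.word w v ∈ c.wtSpace (μ - wordWt R w) := by
  induction w with
  | nil => simpa using hv
  | cons k w ih =>
    have := Chevalley.f_mem_wtSpace ih k
    rw [wordWt_cons, add_comm, ← sub_sub]
    exact this

variable (c) in
/-- The span of the vectors obtained from `m` by applying the `f_k` repeatedly. -/
def Chevalley.wordSpan (m : V) : Submodule ℂ V := Submodule.span ℂ (Set.range fun w => c.word w m)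

theorem Chevalley.word_mem_wordSpan (w : List I) (m : V) : c.word w m ∈ c.wordSpan m :=
  Submodule.subset_span ⟨w, rfl⟩

theorem Chevalley.self_mem_wordSpan (m : V) : m ∈ c.wordSpan m :=
  Chevalley.word_mem_wordSpan [] m

theorem Chevalley.wordSpan_le {m : V} {W : Submodule ℂ V} (h0 : m ∈ W)
    (hf : ∀ k, ∀ v ∈ W, c.f k v ∈ W) : c.wordSpan m ≤ W := by
  refine Submodule.span_le.2 ?_
  rintro _ ⟨w, rfl⟩
  induction w with
  | nil => exact h0
  | cons k w ih => exact hf k _ ih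

theorem mem_of_mem_span {S : Set V} {T : Module.End ℂ V} {W : Submodule ℂ V}
    (h : ∀ s ∈ S, T s ∈ W) {v : V} (hv : v ∈ Submodule.span ℂ S) : T v ∈ W :=
  (Submodule.span_le (p := W.comap T)).2 h hv

theorem Chevalley.f_mem_wordSpan {m v : V} (hv : v ∈ c.wordSpan m) (k : I) :
    c.f k v ∈ c.wordSpan m := by
  refine mem_of_mem_span ?_ hv
  rintro _ ⟨w, rfl⟩
  exact Chevalley.word_mem_wordSpan (k :: w) m

theorem Chevalley.h_mem_wordSpan {m v : V} {lam : Module.Dual ℂ 𝔥} (hm : m ∈ c.wtSpace lam)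
    (hv : v ∈ c.wordSpan m) (x : 𝔥) : c.h x v ∈ c.wordSpan m := by
  refine mem_of_mem_span ?_ hv
  rintro _ ⟨w, rfl⟩
  have := Chevalley.word_mem_wtSpace hm w x
  simp only at this ⊢
  rw [this]
  exact Submodule.smul_mem _ _ (Chevalley.word_mem_wordSpan w m)

/-- Moving e_k to the right past the f_j only produces terms in which 𝔥 acts on a shorter word,
until e_k reaches m and kills it. With stability under f and 𝔥, this makes the span of the words a
submodule. -/
theorem Chevalley.e_mem_wordSpan {m v : V} {lam : Module.Dual ℂ 𝔥} (hm : m ∈ c.wtSpace lam)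
    (he : ∀ k, c.e k m = 0) (hv : v ∈ c.wordSpan m) (k : I) : c.e k v ∈ c.wordSpan m := by
  refine mem_of_mem_span ?_ hv
  rintro _ ⟨w, rfl⟩
  simp only
  induction w with
  | nil => simp [he]
  | cons j w ih =>
    by_cases hkj : k = j
    · subst hkj
      rw [Chevalley.word_cons, Chevalley.e_f]
      exact add_mem (Chevalley.f_mem_wordSpan ih k)
        (Chevalley.h_mem_wordSpan hm (Chevalley.word_mem_wordSpan w m) _)
    · rw [Chevalley.word_cons, Chevalley.e_f_ne hkj]
      exact Chevalley.f_mem_wordSpan ih j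

end Module

end Chevalley

variable {R : Realization A 𝔥}

/-! ### Local nilpotency. -/

section Nilpotent

variable {L M : Type*} [LieRing L] [LieAlgebra ℂ L] [AddCommGroup M] [Module ℂ M]
  [LieRingModule L M] [LieModule ℂ L M]

theorem pow_apply_eq_zero_of_le {V : Type*} [AddCommGroup V] [Module ℂ V] {T : Module.End ℂ V}
    {v : V} {m n : ℕ} (hmn : m ≤ n) (h : (T ^ m) v = 0) : (T ^ n) v = 0 := by
  obtain ⟨k, rfl⟩ := Nat.exists_eq_add_of_le hmn
  rw [add_comm, pow_add, Module.End.mul_apply, h, map_zero]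

/-- By the Leibniz formula for x^(a+b), each term applies x at least a times to y or at least b
times to m. -/
theorem exists_pow_lie_eq_zero {x y : L} {m : M}
    (hy : ∃ n, ((LieAlgebra.ad ℂ L x) ^ n) y = 0)
    (hm : ∃ n, ((LieModule.toEnd ℂ L M x) ^ n) m = 0) :
    ∃ n, ((LieModule.toEnd ℂ L M x) ^ n) ⁅y, m⁆ = 0 := by
  obtain ⟨a, ha⟩ := hy
  obtain ⟨b, hb⟩ := hm
  refine ⟨a + b, ?_⟩
  rw [LieModule.toEnd_pow_lie]
  refine Finset.sum_eq_zero fun p hp => ?_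
  rw [Finset.HasAntidiagonal.mem_antidiagonal] at hp
  rcases le_or_gt a p.1 with h | h
  · rw [pow_apply_eq_zero_of_le h ha, zero_lie, smul_zero]
  · rw [pow_apply_eq_zero_of_le (by omega : b ≤ p.2) hb, lie_zero, smul_zero]

theorem exists_pow_add_eq_zero {V : Type*} [AddCommGroup V] [Module ℂ V] {T : Module.End ℂ V}
    {v w : V} (hv : ∃ n, (T ^ n) v = 0) (hw : ∃ n, (T ^ n) w = 0) : ∃ n, (T ^ n) (v + w) = 0 := by
  obtain ⟨a, ha⟩ := hv
  obtain ⟨b, hb⟩ := hw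
  refine ⟨a + b, ?_⟩
  rw [map_add, pow_apply_eq_zero_of_le (Nat.le_add_right a b) ha,
    pow_apply_eq_zero_of_le (Nat.le_add_left b a) hb, add_zero]

/-- The elements on which `ad x` acts nilpotently. -/
def nilSubalgebra (x : L) : LieSubalgebra ℂ L where
  carrier := {y | ∃ n, ((LieAlgebra.ad ℂ L x) ^ n) y = 0}
  zero_mem' := ⟨0, by simp⟩
  add_mem' := exists_pow_add_eq_zero
  smul_mem' := by
    rintro c y ⟨n, hn⟩
    exact ⟨n, by rw [map_smul, hn, smul_zero]⟩
  lie_mem' := fun hx hy => exists_pow_lie_eq_zero hx hy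

/-- The Lie submodule of vectors on which `x` acts nilpotently, if `ad x` is locally nilpotent. -/
def nilSubmodule (x : L) (hx : ∀ y, ∃ n, ((LieAlgebra.ad ℂ L x) ^ n) y = 0) :
    LieSubmodule ℂ L M where
  carrier := {v | ∃ n, ((LieModule.toEnd ℂ L M x) ^ n) v = 0}
  zero_mem' := ⟨0, by simp⟩
  add_mem' := exists_pow_add_eq_zero
  smul_mem' := by
    rintro c y ⟨n, hn⟩
    exact ⟨n, by rw [map_smul, hn, smul_zero]⟩
  lie_mem := fun hm => exists_pow_lie_eq_zero (hx _) hm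

end Nilpotent

/-! ### 𝔰𝔩₂-theory of primitive vectors. -/

section Sl2

variable {V : Type*} [AddCommGroup V] [Module ℂ V] {c : Chevalley R (Module.End ℂ V)}

theorem Chevalley.h_pow_f (hA : IsGCM A) {k : I} {v : V} {a : ℂ}
    (hv : c.h (R.coroot k) v = a • v) (n : ℕ) :
    c.h (R.coroot k) ((c.f k ^ n) v) = (a - 2 * n) • (c.f k ^ n) v := by
  induction n with
  | zero => simpa using hv
  | succ n ih =>
    rw [pow_succ', Module.End.mul_apply, Chevalley.h_f, ih, R.root_coroot, hA.diag, map_smul,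
      ← sub_smul]
    congr 1
    push_cast
    ring

/-- The factor (n + 1)(a - n) carries two facts: the first vanishing power of f_k on v forces a to
be a natural number, and Serre elements commute with the e_k. -/
theorem Chevalley.e_pow_succ_f (hA : IsGCM A) {k : I} {v : V} {a : ℂ}
    (hv : c.h (R.coroot k) v = a • v) (he : c.e k v = 0) (n : ℕ) :
    c.e k ((c.f k ^ (n + 1)) v) = ((n + 1) * (a - n)) • (c.f k ^ n) v := by
  induction n with
  | zero => simp [Chevalley.e_f, he, hv]
  | succ n ih =>
    rw [pow_succ', Module.End.mul_apply, Chevalley.e_f, ih, map_smul,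
      Chevalley.h_pow_f hA hv, ← Module.End.mul_apply, ← pow_succ', ← add_smul]
    congr 1
    push_cast
    ring

/-- The weight of a primitive vector on which `f` acts nilpotently is a natural number. -/
theorem Chevalley.exists_nat_of_pow_f_eq_zero (hA : IsGCM A) {k : I} {v : V} {a : ℂ} (hv0 : v ≠ 0)
    (hv : c.h (R.coroot k) v = a • v) (he : c.e k v = 0) (hf : ∃ n, (c.f k ^ n) v = 0) :
    ∃ n : ℕ, a = n := by
  classical
  have h1 := Nat.find_spec hf
  rcases h : Nat.find hf with _ | n
  · rw [h] at h1
    exact absurd h1 hv0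
  · have h2 : (c.f k ^ n) v ≠ 0 := Nat.find_min hf (by omega)
    rw [h] at h1
    have h3 := Chevalley.e_pow_succ_f hA hv he n
    rw [h1, map_zero, eq_comm, smul_eq_zero, or_iff_left h2, mul_eq_zero] at h3
    refine ⟨n, ?_⟩
    rcases h3 with h3 | h3
    · exact absurd h3 (Nat.cast_add_one_ne_zero n)
    · exact sub_eq_zero.1 h3

theorem Chevalley.exists_nat_of_pow_e_eq_zero (hA : IsGCM A) {k : I} {v : V} {a : ℂ} (hv0 : v ≠ 0)
    (hv : c.h (R.coroot k) v = a • v) (hf : c.f k v = 0) (he : ∃ n, (c.e k ^ n) v = 0) :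
    ∃ n : ℕ, a = -n := by
  obtain ⟨n, hn⟩ := Chevalley.exists_nat_of_pow_f_eq_zero (c := c.swap) (a := -a) (k := k) hA hv0
    (by simp [Chevalley.swap, hv]) hf he
  exact ⟨n, by rw [← hn, neg_neg]⟩

end Sl2

/-! ### Serre elements and the triangular decomposition. -/

section LieAlgebra

variable {𝔏 : Type*} [LieRing 𝔏] [LieAlgebra ℂ 𝔏] (c : Chevalley R 𝔏)

@[simp] theorem Chevalley.ad_e_apply (i : I) (x : 𝔏) : c.ad.e i x = ⁅c.e i, x⁆ := rfl
@[simp] theorem Chevalley.ad_f_apply (i : I) (x : 𝔏) : c.ad.f i x = ⁅c.f i, x⁆ := rfl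
@[simp] theorem Chevalley.ad_h_apply (y : 𝔥) (x : 𝔏) : c.ad.h y x = ⁅c.h y, x⁆ := rfl

/-- The element `(ad f_i)^{1 - a_ij} f_j`. -/
def Chevalley.serre (i j : I) : 𝔏 := (c.ad.f i ^ (1 - A i j).toNat) (c.f j)

theorem Chevalley.f_mem_wtSpace_ad (i : I) : c.f i ∈ c.ad.wtSpace (-R.root i) := by
  intro x
  simp [c.lie_h_f]

theorem Chevalley.h_mem_wtSpace_ad (x : 𝔥) : c.h x ∈ c.ad.wtSpace 0 := by
  intro y
  simp [c.lie_h_h]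

theorem Chevalley.swap_wtSpace_ad (μ : Module.Dual ℂ 𝔥) :
    c.swap.ad.wtSpace μ = c.ad.wtSpace (-μ) := by
  ext v
  refine forall_congr' fun x => ?_
  simp only [Chevalley.ad_h_apply, Chevalley.swap, LinearMap.neg_apply, neg_lie, neg_smul]
  exact neg_eq_iff_eq_neg

theorem Chevalley.pow_f_mem_wtSpace {V : Type*} [AddCommGroup V] [Module ℂ V]
    {c : Chevalley R (Module.End ℂ V)} {μ : Module.Dual ℂ 𝔥} {v : V} (hv : v ∈ c.wtSpace μ)
    (k : I) (n : ℕ) : (c.f k ^ n) v ∈ c.wtSpace (μ - n • R.root k) := by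
  induction n with
  | zero => simpa using hv
  | succ n ih =>
    rw [pow_succ', Module.End.mul_apply, succ_nsmul, ← sub_sub]
    exact Chevalley.f_mem_wtSpace ih k

theorem Chevalley.exists_serre_mem_wtSpace (i j : I) :
    ∃ μ, c.serre i j ∈ c.ad.wtSpace μ :=
  ⟨_, Chevalley.pow_f_mem_wtSpace (c.f_mem_wtSpace_ad j) i _⟩

/-- The elements `(ad f_i)^{1 - a_ij} f_j` commute with the `e_k`. -/
theorem Chevalley.e_serre (hA : IsGCM A) {i j : I} (hij : i ≠ j) (k : I) :
    ⁅c.e k, c.serre i j⁆ = 0 := by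
  obtain ⟨n, hn⟩ : ∃ n : ℕ, A i j = -n :=
    ⟨(A i j).natAbs, by have := hA.nonpos i j hij; omega⟩
  have hn' : (1 - A i j).toNat = n + 1 := by omega
  have comm : k ≠ i → ∀ (m : ℕ) (v : 𝔏),
      c.ad.e k ((c.ad.f i ^ m) v) = (c.ad.f i ^ m) (c.ad.e k v) := by
    intro hki m v
    induction m with
    | zero => rfl
    | succ m ih =>
      rw [pow_succ', Module.End.mul_apply, Chevalley.e_f_ne hki, ih]
      rfl
  unfold Chevalley.serre
  rw [hn', ← Chevalley.ad_e_apply]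
  by_cases hki : k = i
  · subst hki
    -- Under ad, f_j is a primitive vector with eigenvalue -a_kj = n, so the factor a - n vanishes.
    rw [Chevalley.e_pow_succ_f (a := -(A k j : ℂ)) hA, hn]
    · simp
    · simp [c.lie_h_f, R.root_coroot]
    · simp [c.lie_e_f_ne k j hij]
  · rw [comm hki]
    by_cases hkj : k = j
    · subst hkj
      have h1 : ⁅c.f i, c.h (R.coroot k)⁆ = (A k i : ℂ) • c.f i := by
        rw [← lie_skew, c.lie_h_f, neg_neg, R.root_coroot]
      rw [Chevalley.ad_e_apply, c.lie_e_f, pow_succ, Module.End.mul_apply, Chevalley.ad_f_apply, h1]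
      -- What remains is a_ki (ad f_i)^n f_i. It vanishes for n ≥ 1 because ⁅f_i, f_i⁆ = 0, and for
      -- n = 0 because a_ik = 0 forces a_ki = 0.
      rcases n with _ | n
      · have : A k i = 0 := hA.zero_symm i k (by simpa using hn)
        simp [this]
      · rw [pow_succ, Module.End.mul_apply]
        simp
    · rw [Chevalley.ad_e_apply, c.lie_e_f_ne k j hkj, map_zero]

/-- The span of the iterated brackets of the `f_i`. -/
def Chevalley.neg : Submodule ℂ 𝔏 :=
  Submodule.span ℂ (Set.range fun p : I × List I => c.ad.word p.2 (c.f p.1))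

variable {c}

theorem Chevalley.word_mem_neg (i : I) (w : List I) : c.ad.word w (c.f i) ∈ c.neg :=
  Submodule.subset_span ⟨(i, w), rfl⟩

theorem Chevalley.f_mem_neg (i : I) : c.f i ∈ c.neg := Chevalley.word_mem_neg i []

theorem Chevalley.word_f_mem_wtSpace (i : I) (w : List I) :
    c.ad.word w (c.f i) ∈ c.ad.wtSpace (-wordWt R (i :: w)) := by
  have := Chevalley.word_mem_wtSpace (c.f_mem_wtSpace_ad i) w
  rwa [wordWt_cons, neg_add, ← sub_eq_add_neg]

theorem Chevalley.lie_f_mem_neg {x : 𝔏} (hx : x ∈ c.neg) (k : I) : ⁅c.f k, x⁆ ∈ c.neg := by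
  refine mem_of_mem_span (T := c.ad.f k) ?_ hx
  rintro _ ⟨⟨i, w⟩, rfl⟩
  exact Chevalley.word_mem_neg i (k :: w)

theorem Chevalley.lie_h_mem_neg {x : 𝔏} (hx : x ∈ c.neg) (y : 𝔥) : ⁅c.h y, x⁆ ∈ c.neg := by
  refine mem_of_mem_span (T := c.ad.h y) ?_ hx
  rintro _ ⟨⟨i, w⟩, rfl⟩
  have := Chevalley.word_f_mem_wtSpace (c := c) i w y
  simp only at this ⊢
  rw [this]
  exact Submodule.smul_mem _ _ (Chevalley.word_mem_neg i w)

theorem Chevalley.lie_f_h_mem_neg (k : I) (x : 𝔥) : ⁅c.f k, c.h x⁆ ∈ c.neg := by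
  rw [← lie_skew, c.lie_h_f, neg_neg]
  exact Submodule.smul_mem _ _ (Chevalley.f_mem_neg k)

/-- An element of 𝔥 can only arise from a single letter; any further ad f_j sends it back to a
multiple of f_j. -/
theorem Chevalley.lie_e_mem_neg {x : 𝔏} (hx : x ∈ c.neg) (k : I) :
    ⁅c.e k, x⁆ ∈ c.neg ⊔ LinearMap.range c.h := by
  refine mem_of_mem_span (T := c.ad.e k) ?_ hx
  rintro _ ⟨⟨i, w⟩, rfl⟩
  simp only
  induction w with
  | nil =>
    rw [Chevalley.word_nil, Chevalley.ad_e_apply]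
    by_cases hki : k = i
    · subst hki
      rw [c.lie_e_f]
      exact Submodule.mem_sup_right ⟨_, rfl⟩
    · rw [c.lie_e_f_ne k i hki]
      exact zero_mem _
  | cons j w ih =>
    have h1 : c.ad.f j (c.ad.e k (c.ad.word w (c.f i))) ∈ c.neg := by
      obtain ⟨y, hy, _, ⟨x, rfl⟩, hyx⟩ := Submodule.mem_sup.1 ih
      rw [← hyx, map_add]
      exact add_mem (Chevalley.lie_f_mem_neg hy j) (Chevalley.lie_f_h_mem_neg j x)
    refine Submodule.mem_sup_left ?_
    by_cases hkj : k = j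
    · subst hkj
      rw [Chevalley.word_cons, Chevalley.e_f]
      exact add_mem h1 (Chevalley.lie_h_mem_neg (Chevalley.word_mem_neg i w) _)
    · rw [Chevalley.word_cons, Chevalley.e_f_ne hkj]
      exact h1

theorem Chevalley.range_swap_h : LinearMap.range c.swap.h = LinearMap.range c.h := by
  ext y
  constructor
  · rintro ⟨x, rfl⟩
    exact ⟨-x, by simp [Chevalley.swap]⟩
  · rintro ⟨x, rfl⟩
    exact ⟨-x, by simp [Chevalley.swap]⟩

/-- The sum S is stable under bracketing with each generator. The elements x with [x, S] ⊆ S form a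
subalgebra, so they are everything; hence S is itself a subalgebra, and it contains the generators.
Directness of the sum is not claimed and not needed. -/
theorem Chevalley.Generates.neg_sup_range_sup_neg (hc : c.Generates) :
    c.neg ⊔ LinearMap.range c.h ⊔ c.swap.neg = ⊤ := by
  set S := c.neg ⊔ LinearMap.range c.h ⊔ c.swap.neg with hS
  have main : ∀ d : Chevalley R 𝔏, d.neg ⊔ LinearMap.range d.h ⊔ d.swap.neg = S →
      ∀ k, ∀ x ∈ S, ⁅d.f k, x⁆ ∈ S := by
    intro d hd k x hx
    rw [← hd] at hx ⊢
    obtain ⟨x', hx', z, hz, rfl⟩ := Submodule.mem_sup.1 hx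
    obtain ⟨y, hy, _, ⟨t, rfl⟩, rfl⟩ := Submodule.mem_sup.1 hx'
    rw [lie_add, lie_add]
    refine add_mem (add_mem ?_ ?_) ?_
    · exact Submodule.mem_sup_left (Submodule.mem_sup_left (Chevalley.lie_f_mem_neg hy k))
    · exact Submodule.mem_sup_left (Submodule.mem_sup_left (Chevalley.lie_f_h_mem_neg k t))
    · have := Chevalley.lie_e_mem_neg hz k
      rw [Chevalley.range_swap_h] at this
      exact (sup_le le_sup_right (le_sup_right.trans le_sup_left) :
        d.swap.neg ⊔ LinearMap.range d.h ≤ _) this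
  have hF : ∀ k, ∀ x ∈ S, ⁅c.f k, x⁆ ∈ S := main c rfl
  have hE : ∀ k, ∀ x ∈ S, ⁅c.e k, x⁆ ∈ S := by
    refine main c.swap ?_
    rw [Chevalley.range_swap_h, hS]
    change c.swap.neg ⊔ LinearMap.range c.h ⊔ c.neg = _
    rw [sup_comm, sup_comm c.swap.neg, ← sup_assoc]
  have hH : ∀ y, ∀ x ∈ S, ⁅c.h y, x⁆ ∈ S := by
    intro t x hx
    obtain ⟨x', hx', z, hz, rfl⟩ := Submodule.mem_sup.1 hx
    obtain ⟨y, hy, _, ⟨u, rfl⟩, rfl⟩ := Submodule.mem_sup.1 hx'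
    rw [lie_add, lie_add, c.lie_h_h, add_zero]
    refine add_mem (Submodule.mem_sup_left (Submodule.mem_sup_left ?_)) (Submodule.mem_sup_right ?_)
    · exact Chevalley.lie_h_mem_neg hy t
    · have := Chevalley.lie_h_mem_neg hz (-t)
      simpa [Chevalley.swap] using this
  let K : LieSubalgebra ℂ 𝔏 :=
    { carrier := {x | ∀ y ∈ S, ⁅x, y⁆ ∈ S}
      zero_mem' := fun y _ => by simp
      add_mem' := fun {a b} ha hb y hy => by
        rw [add_lie]
        exact add_mem (ha y hy) (hb y hy)
      smul_mem' := fun r a ha y hy => by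
        rw [smul_lie]
        exact Submodule.smul_mem _ _ (ha y hy)
      lie_mem' := fun {a b} ha hb y hy => by
        rw [lie_lie]
        exact sub_mem (ha _ (hb y hy)) (hb _ (ha y hy)) }
  have hK : K = ⊤ := hc K hE hF hH
  let K' : LieSubalgebra ℂ 𝔏 :=
    { S with lie_mem' := fun {a b} _ hb => (hK ▸ LieSubalgebra.mem_top a : a ∈ K) b hb }
  have hK' : K' = ⊤ := by
    refine hc K' (fun i => ?_) (fun i => ?_) (fun x => ?_)
    · exact Submodule.mem_sup_right (Chevalley.f_mem_neg (c := c.swap) i)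
    · exact Submodule.mem_sup_left (Submodule.mem_sup_left (Chevalley.f_mem_neg i))
    · exact Submodule.mem_sup_left (Submodule.mem_sup_right ⟨x, rfl⟩)
  refine (Submodule.eq_top_iff').2 fun x => ?_
  exact (hK' ▸ LieSubalgebra.mem_top x : x ∈ K')

/-- In the presence of the Serre relations, `ad f_i` is locally nilpotent. -/
theorem Chevalley.Generates.exists_pow_ad_f_eq_zero (hc : c.Generates)
    (hserre : ∀ i j, i ≠ j → c.serre i j = 0) (i : I) (x : 𝔏) :
    ∃ n, ((LieAlgebra.ad ℂ 𝔏 (c.f i)) ^ n) x = 0 := by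
  have hh : ∀ x, ⁅c.f i, c.h x⁆ = R.root i x • c.f i := by
    intro x
    rw [← lie_skew, c.lie_h_f, neg_neg]
  have : nilSubalgebra (c.f i) = ⊤ := by
    refine hc _ (fun j => ?_) (fun j => ?_) (fun y => ⟨2, ?_⟩)
    -- For j = i the chain is e_i ↦ -α_i^∨ ↦ a multiple of f_i ↦ 0.
    · refine ⟨3, ?_⟩
      have h1 : ⁅c.f i, c.e j⁆ = -⁅c.e j, c.f i⁆ := (lie_skew _ _).symm
      by_cases hji : j = i
      · subst hji
        simp [pow_succ, h1, c.lie_e_f, hh]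
      · simp [pow_succ, h1, c.lie_e_f_ne j i hji]
    · by_cases hij : i = j
      · subst hij
        exact ⟨1, by simp⟩
      · exact ⟨_, hserre i j hij⟩
    · simp [pow_succ, hh]
  exact (this ▸ LieSubalgebra.mem_top x : x ∈ nilSubalgebra (c.f i))

end LieAlgebra

/-! ### Integer coordinates on the root lattice. -/

section RootLattice

variable (R) in
/-- The element `∑ q_k α_k` of the root lattice. -/
def rt : (I → ℤ) →+ Module.Dual ℂ 𝔥 where
  toFun q := ∑ k, (q k : ℂ) • R.root k
  map_zero' := by simp
  map_add' p q := by simp [add_smul, Finset.sum_add_distrib]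

theorem rt_injective : Function.Injective (rt R) := by
  refine (injective_iff_map_eq_zero _).2 fun q hq => funext fun k => ?_
  have := Fintype.linearIndependent_iff.1 R.linearIndependent_root (fun k => (q k : ℂ)) hq k
  exact_mod_cast this

theorem rt_single [DecidableEq I] (k : I) : rt R (Pi.single k 1) = R.root k := by
  simp [rt, Pi.single_apply, ite_smul]

theorem rt_apply_coroot (q : I → ℤ) (i : I) :
    rt R q (R.coroot i) = ((∑ j, A i j * q j : ℤ) : ℂ) := by
  simp [rt, R.root_coroot, mul_comm]

theorem wordWt_eq_rt (w : List I) : wordWt R w = rt R (cnt w) := by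
  classical
  induction w with
  | nil => simp
  | cons k w ih => rw [wordWt_cons, cnt_cons, map_add, rt_single, ih]

theorem wordWt_cons_ne_zero (k : I) (w : List I) : wordWt R (k :: w) ≠ 0 := by
  rw [wordWt_eq_rt, ← map_zero (rt R), rt_injective.ne_iff]
  intro h
  have := congrFun h k
  have := cnt_nonneg w k
  simp_all [cnt_cons_self]
  omega

theorem wordWt_cons_ne_neg_root (k i : I) (w : List I) : wordWt R (k :: w) ≠ -R.root i := by
  classical
  rw [wordWt_eq_rt, ← rt_single, ← map_neg, rt_injective.ne_iff]
  intro h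
  have h1 := congrFun h k
  have := cnt_nonneg w k
  rw [cnt_cons_self, Pi.neg_apply] at h1
  by_cases hik : i = k
  · subst hik; simp at h1; omega
  · simp [Ne.symm hik] at h1; omega

theorem eq_of_wordWt_cons_eq_root {k i : I} {w : List I} (h : wordWt R (k :: w) = R.root i) :
    k = i ∧ w = [] := by
  classical
  rw [wordWt_eq_rt, ← rt_single, rt_injective.eq_iff] at h
  have hw : ∀ j, j ∉ w := by
    intro j hj
    have hj := cnt_pos_iff.2 hj
    have h1 := congrFun h j
    have h2 := congrFun h k
    have := cnt_nonneg w k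
    rw [cnt_cons_self] at h2
    by_cases hik : k = i
    · subst hik
      by_cases hjk : j = k
      · subst hjk
        rw [cnt_cons_self] at h1
        simp at h1
        omega
      · rw [cnt_cons_of_ne (Ne.symm hjk)] at h1
        simp [hjk] at h1
        omega
    · simp [hik] at h2
      omega
  have hw' : w = [] := List.eq_nil_iff_forall_not_mem.2 hw
  refine ⟨?_, hw'⟩
  by_contra hki
  have h2 := congrFun h k
  simp [cnt_cons_self, hki, hw'] at h2

end RootLattice

/-! ### Highest weight modules detected by two functionals. -/

section Tester

variable {N : Type*} [AddCommGroup N] [Module ℂ N]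

/-- `n` is a highest weight vector generating `N`, the functionals `φ` and `ψ` are the coefficients
of `n` and `f_i n`, and no nonzero submodule lies in the kernel of both. -/
structure IsTester (c : Chevalley R (Module.End ℂ N)) (lam : Module.Dual ℂ 𝔥) (i : I) (n : N)
    (φ ψ : N →ₗ[ℂ] ℂ) : Prop where
  e_apply : ∀ k, c.e k n = 0
  mem_wtSpace : n ∈ c.wtSpace lam
  wordSpan_eq : c.wordSpan n = ⊤
  φ_self : φ n = 1
  ψ_self : ψ n = 0
  φ_f : ∀ k v, φ (c.f k v) = 0
  ψ_f : ∀ v, ψ (c.f i v) = φ v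
  ψ_f_ne : ∀ k v, k ≠ i → ψ (c.f k v) = 0
  eq_bot : ∀ W : Submodule ℂ N, (∀ k, ∀ v ∈ W, c.e k v ∈ W) → (∀ k, ∀ v ∈ W, c.f k v ∈ W) →
    (∀ x, ∀ v ∈ W, c.h x v ∈ W) → (∀ v ∈ W, φ v = 0 ∧ ψ v = 0) → W = ⊥

variable {c : Chevalley R (Module.End ℂ N)} {lam : Module.Dual ℂ 𝔥} {i : I} {n : N}
  {φ ψ : N →ₗ[ℂ] ℂ}

theorem IsTester.ψ_f_eq_zero (ht : IsTester c lam i n φ ψ) (k : I) {v : N} (hv : φ v = 0) :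
    ψ (c.f k v) = 0 := by
  by_cases h : k = i
  · subst h
    rw [ht.ψ_f, hv]
  · exact ht.ψ_f_ne k v h

theorem IsTester.vanish_word (ht : IsTester c lam i n φ ψ) {v : N} (hv : φ v = 0 ∧ ψ v = 0)
    (w : List I) : φ (c.word w v) = 0 ∧ ψ (c.word w v) = 0 := by
  induction w with
  | nil => exact hv
  | cons k w ih => exact ⟨ht.φ_f _ _, ht.ψ_f_eq_zero k ih.1⟩

/-- The words applied to X n span a submodule on which φ and ψ vanish, so X n = 0. The vectors
killed by all of X are then stable under the f_k, since X is stable under ad f_k, and contain the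
generator n. -/
theorem IsTester.eq_zero_of_forall_mem (ht : IsTester c lam i n φ ψ)
    {X : Submodule ℂ (Module.End ℂ N)} (hE : ∀ k, ∀ T ∈ X, ⁅c.e k, T⁆ ∈ X)
    (hF : ∀ k, ∀ T ∈ X, ⁅c.f k, T⁆ ∈ X) (hH : ∀ x, ∀ T ∈ X, ⁅c.h x, T⁆ ∈ X)
    (hX : ∀ T ∈ X, φ (T n) = 0 ∧ ψ (T n) = 0) : ∀ T ∈ X, T = 0 := by
  have key : ∀ T ∈ X, T n = 0 := by
    let S : Set N := {v | ∃ w, ∃ T ∈ X, v = c.word w (T n)}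
    have hSF : ∀ k, ∀ v ∈ Submodule.span ℂ S, c.f k v ∈ Submodule.span ℂ S := by
      intro k v hv
      refine mem_of_mem_span ?_ hv
      rintro _ ⟨w, T, hT, rfl⟩
      exact Submodule.subset_span ⟨k :: w, T, hT, rfl⟩
    have hSH : ∀ x, ∀ v ∈ Submodule.span ℂ S, c.h x v ∈ Submodule.span ℂ S := by
      intro x v hv
      refine mem_of_mem_span ?_ hv
      rintro _ ⟨w, T, hT, rfl⟩
      induction w with
      | nil =>
        have h1 : c.h x (T n) = ⁅c.h x, T⁆ n + lam x • T n := by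
          have := ht.mem_wtSpace x
          simp only at this
          simp [Ring.lie_def, this]
        rw [Chevalley.word_nil, h1]
        exact add_mem (Submodule.subset_span ⟨[], _, hH x T hT, rfl⟩)
          (Submodule.smul_mem _ _ (Submodule.subset_span ⟨[], T, hT, rfl⟩))
      | cons k w ih =>
        rw [Chevalley.word_cons, Chevalley.h_f]
        exact sub_mem (hSF k _ ih)
          (Submodule.smul_mem _ _ (Submodule.subset_span ⟨k :: w, T, hT, rfl⟩))
    have hSE : ∀ k, ∀ v ∈ Submodule.span ℂ S, c.e k v ∈ Submodule.span ℂ S := by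
      intro k v hv
      refine mem_of_mem_span ?_ hv
      rintro _ ⟨w, T, hT, rfl⟩
      induction w with
      | nil =>
        have h1 : c.e k (T n) = ⁅c.e k, T⁆ n := by
          simp [Ring.lie_def, ht.e_apply]
        rw [Chevalley.word_nil, h1]
        exact Submodule.subset_span ⟨[], _, hE k T hT, rfl⟩
      | cons j w ih =>
        rw [Chevalley.word_cons]
        by_cases hkj : k = j
        · subst hkj
          rw [Chevalley.e_f]
          exact add_mem (hSF k _ ih) (hSH _ _ (Submodule.subset_span ⟨w, T, hT, rfl⟩))
        · rw [Chevalley.e_f_ne hkj]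
          exact hSF j _ ih
    have hS := ht.eq_bot (Submodule.span ℂ S) hSE hSF hSH fun v hv => by
      have : Submodule.span ℂ S ≤ LinearMap.ker φ ⊓ LinearMap.ker ψ := by
        refine Submodule.span_le.2 ?_
        rintro _ ⟨w, T, hT, rfl⟩
        exact ht.vanish_word (hX T hT) w
      exact this hv
    intro T hT
    rw [← Submodule.mem_bot ℂ, ← hS]
    exact Submodule.subset_span ⟨[], T, hT, rfl⟩
  let Z : Submodule ℂ N :=
    { carrier := {v | ∀ T ∈ X, T v = 0}
      zero_mem' := by simp
      add_mem' := fun {a b} ha hb T hT => by rw [map_add, ha T hT, hb T hT, add_zero]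
      smul_mem' := fun r a ha T hT => by rw [map_smul, ha T hT, smul_zero] }
  have hZ : (⊤ : Submodule ℂ N) ≤ Z := by
    rw [← ht.wordSpan_eq]
    refine Chevalley.wordSpan_le key fun k v hv T hT => ?_
    have h1 := hv _ (hF k T hT)
    rw [Ring.lie_def, LinearMap.sub_apply, Module.End.mul_apply, hv T hT, map_zero, zero_sub,
      neg_eq_zero] at h1
    exact h1
  exact fun T hT => LinearMap.ext fun v => hZ (Submodule.mem_top : v ∈ ⊤) T hT

/-- Being killed by every ad e_l, the Serre element generates an ad-stable space using the f_l
alone. Its elements are iterated commutators of at least two f's, whose images have no n- or f_i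
n-coefficient. -/
theorem IsTester.serre_eq_zero (ht : IsTester c lam i n φ ψ) (hA : IsGCM A) {j k : I}
    (hjk : j ≠ k) : c.serre j k = 0 := by
  obtain ⟨μ, hμ⟩ := c.exists_serre_mem_wtSpace j k
  refine ht.eq_zero_of_forall_mem (X := c.ad.wordSpan (c.serre j k)) (fun l T hT => ?_)
    (fun l T hT => ?_) (fun x T hT => ?_) (fun T hT => ?_) _ (Chevalley.self_mem_wordSpan _)
  · exact Chevalley.e_mem_wordSpan hμ (c.e_serre hA hjk) hT l
  · exact Chevalley.f_mem_wordSpan hT l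
  · exact Chevalley.h_mem_wordSpan hμ hT x
  · let Y : Submodule ℂ (Module.End ℂ N) :=
      { carrier := {T | ∀ v, φ (T v) = 0 ∧ ψ (T v) = 0}
        zero_mem' := by simp
        add_mem' := fun {a b} ha hb v => by simp [ha v, hb v]
        smul_mem' := fun r a ha v => by simp [ha v] }
    have hY : ∀ l, ∀ T ∈ Y, c.ad.f l T ∈ Y := by
      intro l T hT v
      simp only [Chevalley.ad_f_apply, Ring.lie_def, LinearMap.sub_apply, Module.End.mul_apply,
        map_sub, ht.φ_f, (hT _).1, (hT _).2, ht.ψ_f_eq_zero l (hT v).1, sub_zero, and_self]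
    have h1 : ∀ m, (c.ad.f j ^ (m + 1)) (c.f k) ∈ Y := by
      intro m
      induction m with
      | zero =>
        intro v
        simp [Ring.lie_def, ht.φ_f, ht.ψ_f_eq_zero]
      | succ m ih =>
        rw [pow_succ', Module.End.mul_apply]
        exact hY j _ ih
    have h2 : c.serre j k ∈ Y := by
      have := hA.nonpos j k hjk
      obtain ⟨m, hm⟩ : ∃ m, (1 - A j k).toNat = m + 1 := ⟨(1 - A j k).toNat - 1, by omega⟩
      rw [Chevalley.serre, hm]
      exact h1 m
    exact Chevalley.wordSpan_le h2 hY hT n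

/-- The same argument with the e's: here all operators concerned are iterated commutators of e's and
kill n outright. -/
theorem IsTester.swap_serre_eq_zero (ht : IsTester c lam i n φ ψ) (hA : IsGCM A) {j k : I}
    (hjk : j ≠ k) : c.swap.serre j k = 0 := by
  obtain ⟨μ, hμ⟩ := c.swap.exists_serre_mem_wtSpace j k
  refine ht.eq_zero_of_forall_mem (X := c.swap.ad.wordSpan (c.swap.serre j k)) (fun l T hT => ?_)
    (fun l T hT => ?_) (fun x T hT => ?_) (fun T hT => ?_) _ (Chevalley.self_mem_wordSpan _)
  · exact Chevalley.f_mem_wordSpan hT l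
  · exact Chevalley.e_mem_wordSpan hμ (c.swap.e_serre hA hjk) hT l
  · have := Chevalley.h_mem_wordSpan hμ hT (-x)
    simpa [Chevalley.swap] using this
  · let Y : Submodule ℂ (Module.End ℂ N) :=
      { carrier := {T | T n = 0}
        zero_mem' := by simp
        add_mem' := fun {a b} ha hb => by
          simp only [Set.mem_ofPred_eq] at ha hb
          simp [ha, hb]
        smul_mem' := fun r a ha => by
          simp only [Set.mem_ofPred_eq] at ha
          simp [ha] }
    have hY : ∀ l, ∀ T ∈ Y, c.swap.ad.f l T ∈ Y := by
      intro l T hT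
      change ⁅c.e l, T⁆ n = 0
      have hT : T n = 0 := hT
      simp [Ring.lie_def, ht.e_apply, hT]
    have h1 : ∀ m, (c.swap.ad.f j ^ m) (c.e k) ∈ Y := by
      intro m
      induction m with
      | zero => exact ht.e_apply k
      | succ m ih =>
        rw [pow_succ', Module.End.mul_apply]
        exact hY j _ ih
    have : T n = 0 := Chevalley.wordSpan_le (h1 _) hY hT
    simp [this]

end Tester

/-! ### Construction of the tester module from the free module on words. -/

section Construction

variable (R) (lam : Module.Dual ℂ 𝔥)

/-- The action of `e_k` on a word. -/
def freeModEWord (k : I) : List I → (List I →₀ ℂ)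
  | [] => 0
  -- This is e_k f_j = f_j e_k + δ_kj α_k^∨ applied to the word w, which has weight λ minus the sum
  -- of its letters.
  | j :: w => freeModF j (freeModEWord k w) +
      open Classical in if k = j then
        Finsupp.single w ((lam - wordWt R w) (R.coroot k)) else 0

/-- The free module on the words as a module over `𝔤̃(A)`, of highest weight `lam`. -/
def freeModE (k : I) : Module.End ℂ (List I →₀ ℂ) :=
  Finsupp.linearCombination ℂ (freeModEWord R lam k)

/-- The action of `𝔥` on the free module on the words. -/
def freeModH : 𝔥 →ₗ[ℂ] Module.End ℂ (List I →₀ ℂ) where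
  toFun x := Finsupp.linearCombination ℂ fun w => ((lam - wordWt R w) x) • Finsupp.single w 1
  map_add' x y := by
    refine Finsupp.lhom_ext' fun w => LinearMap.ext_ring ?_
    simp only [LinearMap.coe_comp, Function.comp_apply, Finsupp.lsingle_apply, LinearMap.add_apply,
      Finsupp.linearCombination_single, one_smul, map_add, add_smul]
  map_smul' a x := by
    refine Finsupp.lhom_ext' fun w => LinearMap.ext_ring ?_
    simp only [LinearMap.coe_comp, Function.comp_apply, Finsupp.lsingle_apply, LinearMap.smul_apply,
      Finsupp.linearCombination_single, one_smul, map_smul, smul_assoc, RingHom.id_apply]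

@[simp] theorem freeModE_single (k : I) (w : List I) (a : ℂ) :
    freeModE R lam k (Finsupp.single w a) = a • freeModEWord R lam k w := by
  simp [freeModE]

@[simp] theorem freeModH_single (x : 𝔥) (w : List I) (a : ℂ) :
    freeModH R lam x (Finsupp.single w a) = ((lam - wordWt R w) x) • Finsupp.single w a := by
  simp only [freeModH, LinearMap.coe_mk, AddHom.coe_mk, Finsupp.linearCombination_single]
  rw [smul_comm, Finsupp.smul_single_one]

theorem freeModH_freeModF (x : 𝔥) (k : I) (v : List I →₀ ℂ) :
    freeModH R lam x (freeModF k v) =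
      freeModF k (freeModH R lam x v) - R.root k x • freeModF k v := by
  induction v using Finsupp.induction_linear with
  | zero => simp
  | add v w hv hw => simp only [map_add, hv, hw, smul_add]; abel
  | single w a =>
    rw [freeModF_single, freeModH_single, freeModH_single, map_smul, freeModF_single, ← sub_smul]
    congr 1
    simp only [wordWt_cons, LinearMap.sub_apply, LinearMap.add_apply]
    ring

theorem freeModE_freeModF (k : I) (v : List I →₀ ℂ) :
    freeModE R lam k (freeModF k v) =
      freeModF k (freeModE R lam k v) + freeModH R lam (R.coroot k) v := by
  induction v using Finsupp.induction_linear with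
  | zero => simp
  | add v w hv hw => simp only [map_add, hv, hw]; abel
  | single w a =>
    rw [freeModF_single, freeModE_single, freeModE_single, freeModEWord, if_pos rfl, map_smul,
      smul_add, freeModH_single, Finsupp.smul_single, Finsupp.smul_single, smul_eq_mul,
      smul_eq_mul, mul_comm a]

theorem freeModE_freeModF_ne {k j : I} (hkj : k ≠ j) (v : List I →₀ ℂ) :
    freeModE R lam k (freeModF j v) = freeModF j (freeModE R lam k v) := by
  induction v using Finsupp.induction_linear with
  | zero => simp
  | add v w hv hw => simp only [map_add, hv, hw]
  | single w a =>
    rw [freeModF_single, freeModE_single, freeModE_single, freeModEWord, if_neg hkj, map_smul,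
      add_zero]

theorem freeModH_freeModE (x : 𝔥) (k : I) (v : List I →₀ ℂ) :
    freeModH R lam x (freeModE R lam k v) =
      freeModE R lam k (freeModH R lam x v) + R.root k x • freeModE R lam k v := by
  induction v using Finsupp.induction_linear with
  | zero => simp
  | add v w hv hw => simp only [map_add, hv, hw, smul_add]; abel
  | single w a =>
    rw [freeModE_single, freeModH_single, map_smul, map_smul, freeModE_single,
      ← add_smul]
    suffices h : freeModH R lam x (freeModEWord R lam k w) =
        ((lam - wordWt R w) x + R.root k x) • freeModEWord R lam k w by
      rw [h, smul_comm]
    induction w with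
    | nil => simp [freeModEWord]
    | cons j w ih =>
      rw [freeModEWord, map_add, freeModH_freeModF, ih, smul_add, map_smul, ← sub_smul]
      congr 1
      · congr 1
        simp only [wordWt_cons, LinearMap.sub_apply, LinearMap.add_apply]
        ring
      · split_ifs with h
        · subst h
          rw [freeModH_single]
          congr 1
          simp only [wordWt_cons, LinearMap.sub_apply, LinearMap.add_apply]
          ring
        · simp

/-- The Chevalley operators on the free module on the words. -/
def freeMod : Chevalley R (Module.End ℂ (List I →₀ ℂ)) where
  e := freeModE R lam
  f := freeModF
  h := freeModH R lam
  lie_h_h x y := by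
    refine Finsupp.lhom_ext' fun w => LinearMap.ext_ring ?_
    simp only [LinearMap.coe_comp, Function.comp_apply, Finsupp.lsingle_apply, Ring.lie_def,
      LinearMap.sub_apply, Module.End.mul_apply, freeModH_single, map_smul, LinearMap.zero_apply]
    rw [smul_comm, sub_self]
  lie_h_e x i := LinearMap.ext fun v => by simp [Ring.lie_def, freeModH_freeModE]
  lie_h_f x i := LinearMap.ext fun v => by simp [Ring.lie_def, freeModH_freeModF]
  lie_e_f i := LinearMap.ext fun v => by simp [Ring.lie_def, freeModE_freeModF]
  lie_e_f_ne i j hij := LinearMap.ext fun v => by simp [Ring.lie_def, freeModE_freeModF_ne R lam hij]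

variable {R} {V : Type*} [AddCommGroup V] [Module ℂ V]

/-- The induced operators on the quotient by a stable subspace. -/
def Chevalley.quot (c : Chevalley R (Module.End ℂ V)) (W : Submodule ℂ V)
    (hE : ∀ k, W ≤ W.comap (c.e k)) (hF : ∀ k, W ≤ W.comap (c.f k))
    (hH : ∀ x, W ≤ W.comap (c.h x)) : Chevalley R (Module.End ℂ (V ⧸ W)) where
  e k := W.mapQ W (c.e k) (hE k)
  f k := W.mapQ W (c.f k) (hF k)
  h :=
    { toFun := fun x => W.mapQ W (c.h x) (hH x)
      map_add' := fun x y => by ext v; simp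
      map_smul' := fun a x => by ext v; simp }
  lie_h_h x y := by
    ext v
    have := LinearMap.congr_fun (c.lie_h_h x y) v
    simp only [Ring.lie_def, LinearMap.sub_apply, Module.End.mul_apply, LinearMap.zero_apply] at this
    simp [Ring.lie_def, ← Submodule.Quotient.mk_sub, this]
  lie_h_e x i := by
    ext v
    simp [Ring.lie_def, Chevalley.h_e]
  lie_h_f x i := by
    ext v
    simp [Ring.lie_def, Chevalley.h_f]
  lie_e_f i := by
    ext v
    simp [Ring.lie_def, Chevalley.e_f]
  lie_e_f_ne i j hij := by
    ext v
    simp [Ring.lie_def, Chevalley.e_f_ne hij]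

/-- The largest subspace of `P` stable under the Chevalley operators. -/
def Chevalley.core (c : Chevalley R (Module.End ℂ V)) (P : Submodule ℂ V) : Submodule ℂ V where
  carrier := {v | ∀ a ∈ Algebra.adjoin ℂ (Set.range c.e ∪ Set.range c.f ∪ Set.range c.h), a v ∈ P}
  zero_mem' := fun a _ => by simp
  add_mem' := fun {v w} hv hw a ha => by
    rw [map_add]
    exact add_mem (hv a ha) (hw a ha)
  smul_mem' := fun r v hv a ha => by
    rw [map_smul]
    exact P.smul_mem _ (hv a ha)

variable {c : Chevalley R (Module.End ℂ V)} {P : Submodule ℂ V}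

theorem Chevalley.core_le : c.core P ≤ P := fun _ hv => hv 1 (one_mem _)

theorem Chevalley.core_stable {T : Module.End ℂ V}
    (hT : T ∈ Set.range c.e ∪ Set.range c.f ∪ Set.range c.h) : c.core P ≤ (c.core P).comap T :=
  fun _ hv a ha => hv (a * T) (mul_mem ha (Algebra.subset_adjoin hT))

theorem Chevalley.le_core {W : Submodule ℂ V} (hE : ∀ k, ∀ v ∈ W, c.e k v ∈ W)
    (hF : ∀ k, ∀ v ∈ W, c.f k v ∈ W) (hH : ∀ x, ∀ v ∈ W, c.h x v ∈ W) (hP : W ≤ P) :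
    W ≤ c.core P := by
  intro v hv a ha
  refine hP ?_
  clear hP
  revert v
  induction ha using Algebra.adjoin_induction with
  | mem a ha =>
    rcases ha with (⟨k, rfl⟩ | ⟨k, rfl⟩) | ⟨x, rfl⟩
    · exact hE k
    · exact hF k
    · exact hH x
  | algebraMap r => exact fun v hv => W.smul_mem r hv
  | add a b _ _ iha ihb => exact fun v hv => add_mem (iha hv) (ihb hv)
  | mul a b _ _ iha ihb => exact fun v hv => iha (ihb hv)

variable (R) (i : I)

/-- The vectors in which the words `[]` and `[i]` do not occur. -/
def avoiding (i : I) : Submodule ℂ (List I →₀ ℂ) :=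
  LinearMap.ker (Finsupp.lapply [] : (List I →₀ ℂ) →ₗ[ℂ] ℂ) ⊓
    LinearMap.ker (Finsupp.lapply [i] : (List I →₀ ℂ) →ₗ[ℂ] ℂ)

/-- The submodule to be divided out of the free module on the words. -/
def testerKer : Submodule ℂ (List I →₀ ℂ) := (freeMod R lam).core (avoiding i)

/-- The quotient of the free module on the words by its largest submodule in which neither the
highest weight vector nor its image under `f_i` occurs. -/
abbrev TesterMod := (List I →₀ ℂ) ⧸ testerKer R lam i

/-- The Chevalley operators on `TesterMod`. -/
def tester : Chevalley R (Module.End ℂ (TesterMod R lam i)) :=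
  (freeMod R lam).quot (testerKer R lam i)
    (fun _ => Chevalley.core_stable (Or.inl (Or.inl ⟨_, rfl⟩)))
    (fun _ => Chevalley.core_stable (Or.inl (Or.inr ⟨_, rfl⟩)))
    (fun _ => Chevalley.core_stable (Or.inr ⟨_, rfl⟩))

/-- The highest weight vector of `TesterMod`. -/
def testerVec : TesterMod R lam i := (testerKer R lam i).mkQ (Finsupp.single [] 1)

/-- The coefficient of the highest weight vector. -/
def testerφ : TesterMod R lam i →ₗ[ℂ] ℂ :=
  (testerKer R lam i).liftQ (Finsupp.lapply []) (Chevalley.core_le.trans inf_le_left)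

/-- The coefficient of the image of the highest weight vector under `f_i`. -/
def testerψ : TesterMod R lam i →ₗ[ℂ] ℂ :=
  (testerKer R lam i).liftQ (Finsupp.lapply [i]) (Chevalley.core_le.trans inf_le_right)

theorem freeMod_word (w : List I) :
    (freeMod R lam).word w (Finsupp.single [] 1) = Finsupp.single w 1 := by
  induction w with
  | nil => rfl
  | cons k w ih =>
    rw [Chevalley.word_cons, ih]
    exact freeModF_single k w 1

theorem tester_word (w : List I) (v : List I →₀ ℂ) :
    (tester R lam i).word w ((testerKer R lam i).mkQ v) =
      (testerKer R lam i).mkQ ((freeMod R lam).word w v) := by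
  induction w with
  | nil => rfl
  | cons k w ih =>
    rw [Chevalley.word_cons, ih]
    rfl

/-- Each f_k prepends a letter, so the rules for φ and ψ are read off the words [] and [i]. The last
property is maximality of the subspace divided out: the preimage of W is stable and avoids both
words. -/
theorem isTester :
    IsTester (tester R lam i) lam i (testerVec R lam i) (testerφ R lam i) (testerψ R lam i) where
  e_apply k := by
    change (testerKer R lam i).mkQ (freeModE R lam k (Finsupp.single [] 1)) = 0
    simp [freeModEWord]
  mem_wtSpace x := by
    change (testerKer R lam i).mkQ (freeModH R lam x (Finsupp.single [] 1)) = _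
    rw [freeModH_single, map_smul, wordWt_nil, sub_zero]
    rfl
  wordSpan_eq := by
    refine (Submodule.eq_top_iff').2 fun v => ?_
    obtain ⟨v, rfl⟩ := (testerKer R lam i).mkQ_surjective v
    induction v using Finsupp.induction_linear with
    | zero => simp
    | add v w hv hw =>
      rw [map_add]
      exact add_mem hv hw
    | single w a =>
      rw [← mul_one a, ← smul_eq_mul, ← Finsupp.smul_single, map_smul, ← freeMod_word R lam,
        ← tester_word]
      exact Submodule.smul_mem _ _ (Chevalley.word_mem_wordSpan w _)
  φ_self := Finsupp.single_eq_same
  ψ_self := Finsupp.single_eq_of_ne (by simp)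
  φ_f k v := by
    obtain ⟨v, rfl⟩ := (testerKer R lam i).mkQ_surjective v
    exact freeModF_apply_nil k v
  ψ_f v := by
    obtain ⟨v, rfl⟩ := (testerKer R lam i).mkQ_surjective v
    exact freeModF_apply_cons i v []
  ψ_f_ne k v hk := by
    obtain ⟨v, rfl⟩ := (testerKer R lam i).mkQ_surjective v
    exact freeModF_apply_cons_ne hk v []
  eq_bot W hE hF hH hW := by
    have : W.comap (testerKer R lam i).mkQ ≤ testerKer R lam i :=
      Chevalley.le_core (fun k v hv => hE k _ hv) (fun k v hv => hF k _ hv)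
        (fun x v hv => hH x _ hv) fun v hv => hW _ hv
    refine (Submodule.eq_bot_iff _).2 fun v hv => ?_
    obtain ⟨v, rfl⟩ := (testerKer R lam i).mkQ_surjective v
    exact (Submodule.Quotient.mk_eq_zero _).2 (this hv)

end Construction

/-! ### Quotient Lie algebras and maps out of the presentation. -/

section Quotient

variable {L L' : Type*} [LieRing L] [LieAlgebra ℂ L] [LieRing L'] [LieAlgebra ℂ L']

/-- The projection to the quotient by an ideal. -/
def quotHom (J : LieIdeal ℂ L) : L →ₗ⁅ℂ⁆ L ⧸ J :=
  { J.toSubmodule.mkQ with map_lie' := fun {_ _} => rfl }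

theorem quotHom_surjective (J : LieIdeal ℂ L) : Function.Surjective (quotHom J) :=
  J.toSubmodule.mkQ_surjective

theorem quotHom_eq_zero_iff {J : LieIdeal ℂ L} {x : L} : quotHom J x = 0 ↔ x ∈ J :=
  Submodule.Quotient.mk_eq_zero _

/-- The homomorphism induced on the quotient by an ideal. -/
def quotLift (J : LieIdeal ℂ L) (φ : L →ₗ⁅ℂ⁆ L') (h : ∀ x ∈ J, φ x = 0) : L ⧸ J →ₗ⁅ℂ⁆ L' :=
  { J.toSubmodule.liftQ (φ : L →ₗ[ℂ] L') h with
    map_lie' := by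
      intro x y
      obtain ⟨x, rfl⟩ := quotHom_surjective J x
      obtain ⟨y, rfl⟩ := quotHom_surjective J y
      exact φ.map_lie x y }

theorem LieHom.map_ad_pow (φ : L →ₗ⁅ℂ⁆ L') (x y : L) (n : ℕ) :
    φ (((LieAlgebra.ad ℂ L x) ^ n) y) = ((LieAlgebra.ad ℂ L' (φ x)) ^ n) (φ y) := by
  induction n with
  | zero => rfl
  | succ n ih => rw [pow_succ', pow_succ', Module.End.mul_apply, Module.End.mul_apply, ← ih,
      LieAlgebra.ad_apply, LieAlgebra.ad_apply, LieHom.map_lie]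

theorem Chevalley.map_serre (c : Chevalley R L) (φ : L →ₗ⁅ℂ⁆ L') (i j : I) :
    (c.map φ).serre i j = φ (c.serre i j) :=
  (LieHom.map_ad_pow φ _ _ _).symm

theorem Chevalley.map_swap_serre (c : Chevalley R L) (φ : L →ₗ⁅ℂ⁆ L') (i j : I) :
    (c.map φ).swap.serre i j = φ (c.swap.serre i j) :=
  (LieHom.map_ad_pow φ _ _ _).symm

theorem Chevalley.Generates.map {c : Chevalley R L} (hc : c.Generates) {φ : L →ₗ⁅ℂ⁆ L'}
    (hφ : Function.Surjective φ) : (c.map φ).Generates := by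
  intro K he hf hh
  have := hc (K.comap φ) he hf hh
  rw [eq_top_iff]
  intro y _
  obtain ⟨x, rfl⟩ := hφ y
  exact (this ▸ LieSubalgebra.mem_top x : x ∈ K.comap φ)

/-- The homomorphism from the free Lie algebra given by Chevalley elements. -/
def Chevalley.freeLift (c : Chevalley R L) : Free I 𝔥 →ₗ⁅ℂ⁆ L :=
  FreeLieAlgebra.lift ℂ fun
    | Gen.e i => c.e i
    | Gen.f i => c.f i
    | Gen.h x => c.h x

variable (c : Chevalley R L)

@[simp] theorem Chevalley.freeLift_e (i : I) : c.freeLift (freeE 𝔥 i) = c.e i :=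
  FreeLieAlgebra.lift_of_apply _ _

@[simp] theorem Chevalley.freeLift_f (i : I) : c.freeLift (freeF 𝔥 i) = c.f i :=
  FreeLieAlgebra.lift_of_apply _ _

@[simp] theorem Chevalley.freeLift_h (x : 𝔥) : c.freeLift (freeH I x) = c.h x :=
  FreeLieAlgebra.lift_of_apply _ _

theorem Chevalley.freeLift_eq_zero_of_mem (h : ∀ i j, i ≠ j → c.serre i j = 0)
    (h' : ∀ i j, i ≠ j → c.swap.serre i j = 0) : ∀ x ∈ relIdeal R, c.freeLift x = 0 := by
  have : relIdeal R ≤ c.freeLift.ker := by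
    refine LieSubmodule.lieSpan_le.2 fun x hx => ?_
    rw [SetLike.mem_coe, LieHom.mem_ker]
    have hx : Relator R x := hx
    cases hx with
    | add x y => simp
    | smul a x => simp
    | hh x y => simp [c.lie_h_h]
    | he x i => simp [c.lie_h_e]
    | hf x i => simp [c.lie_h_f]
    | ef i => simp [c.lie_e_f]
    | ef_ne i j hij => simp [c.lie_e_f_ne i j hij]
    | serreE i j hij =>
      rw [LieHom.map_ad_pow, Chevalley.freeLift_e, Chevalley.freeLift_e]
      exact h' i j hij
    | serreF i j hij =>
      rw [LieHom.map_ad_pow, Chevalley.freeLift_f, Chevalley.freeLift_f]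
      exact h i j hij
  exact fun x hx => this hx

/-- The homomorphism from `𝔤̄(A)` given by Chevalley elements satisfying the Serre relations. -/
def Chevalley.serreLift (h : ∀ i j, i ≠ j → c.serre i j = 0)
    (h' : ∀ i j, i ≠ j → c.swap.serre i j = 0) : SerreAlgebra R →ₗ⁅ℂ⁆ L :=
  quotLift (relIdeal R) c.freeLift (c.freeLift_eq_zero_of_mem h h')

end Quotient

/-! ### The algebras 𝔤̄(A) and 𝔤(A), and the radical. -/

section Algebra

variable (R)

theorem toSerre_eq_zero {x : Free I 𝔥} (h : Relator R x) : toSerre R x = 0 :=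
  (Submodule.Quotient.mk_eq_zero _).2 (LieSubmodule.subset_lieSpan h)

/-- The Chevalley generators of `𝔤̄(A)`. -/
def serreGen : Chevalley R (SerreAlgebra R) where
  e i := toSerre R (freeE 𝔥 i)
  f i := toSerre R (freeF 𝔥 i)
  h :=
    { toFun := fun x => toSerre R (freeH I x)
      map_add' := fun x y => sub_eq_zero.1 (toSerre_eq_zero R (Relator.add x y))
      map_smul' := fun a x => sub_eq_zero.1 (toSerre_eq_zero R (Relator.smul a x)) }
  lie_h_h x y := toSerre_eq_zero R (Relator.hh x y)
  lie_h_e x i := sub_eq_zero.1 (toSerre_eq_zero R (Relator.he x i))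
  lie_h_f x i := eq_neg_of_add_eq_zero_left (toSerre_eq_zero R (Relator.hf x i))
  lie_e_f i := sub_eq_zero.1 (toSerre_eq_zero R (Relator.ef i))
  lie_e_f_ne i j hij := toSerre_eq_zero R (Relator.ef_ne i j hij)

theorem generates_serreGen : (serreGen R).Generates := by
  intro K he hf hh
  let g : Gen I 𝔥 → K := fun
    | Gen.e i => ⟨_, he i⟩
    | Gen.f i => ⟨_, hf i⟩
    | Gen.h x => ⟨_, hh x⟩
  have hg : K.incl.comp (FreeLieAlgebra.lift ℂ g) = quotHom (relIdeal R) := by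
    refine FreeLieAlgebra.hom_ext fun x => ?_
    rw [LieHom.comp_apply, FreeLieAlgebra.lift_of_apply]
    cases x <;> rfl
  rw [eq_top_iff]
  intro y _
  obtain ⟨x, rfl⟩ := quotHom_surjective _ y
  rw [← hg]
  exact (FreeLieAlgebra.lift ℂ g x).2

theorem serreGen_serre {i j : I} (hij : i ≠ j) : (serreGen R).serre i j = 0 := by
  rw [← toSerre_eq_zero R (Relator.serreF i j hij)]
  exact (LieHom.map_ad_pow (quotHom (relIdeal R)) _ _ _).symm

theorem serreGen_swap_serre {i j : I} (hij : i ≠ j) : (serreGen R).swap.serre i j = 0 := by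
  rw [← toSerre_eq_zero R (Relator.serreE i j hij)]
  exact (LieHom.map_ad_pow (quotHom (relIdeal R)) _ _ _).symm

/-- The Chevalley generators of `𝔤(A)`. -/
def kmGen : Chevalley R (KMAlgebra R) := (serreGen R).map (quotHom (radIdeal R))

theorem generates_kmGen : (kmGen R).Generates :=
  (generates_serreGen R).map (quotHom_surjective _)

theorem kmGen_serre {i j : I} (hij : i ≠ j) : (kmGen R).serre i j = 0 := by
  rw [kmGen, Chevalley.map_serre, serreGen_serre R hij, map_zero]

theorem kmGen_swap_serre {i j : I} (hij : i ≠ j) : (kmGen R).swap.serre i j = 0 := by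
  rw [kmGen, Chevalley.map_swap_serre, serreGen_swap_serre R hij, map_zero]

variable {R}

theorem Chevalley.swap_word_mem_wtSpace {L : Type*} [LieRing L] [LieAlgebra ℂ L]
    {c : Chevalley R L} (i : I) (w : List I) :
    c.swap.ad.word w (c.e i) ∈ c.ad.wtSpace (wordWt R (i :: w)) := by
  have := Chevalley.word_f_mem_wtSpace (c := c.swap) i w
  rwa [Chevalley.swap_wtSpace_ad, neg_neg] at this

/-- Ideals of `𝔤̄(A)` are stable under `𝔥`. -/
theorem LieIdeal.h_mem {L : Type*} [LieRing L] [LieAlgebra ℂ L] (c : Chevalley R L)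
    (K : LieIdeal ℂ L) (y : 𝔥) : ∀ x ∈ K.toSubmodule, c.ad.h y x ∈ K.toSubmodule :=
  fun _ hx => lie_mem_right ℂ L K _ _ hx

/-- By the triangular decomposition, as nonempty words have nonzero weight, only 𝔥 contributes in
weight zero. -/
theorem range_h_sup_iSup : LinearMap.range (serreGen R).h ⊔
    (⨆ ν : {ν // ν ≠ 0}, (serreGen R).ad.wtSpace ν.1) = ⊤ := by
  rw [eq_top_iff, ← (generates_serreGen R).neg_sup_range_sup_neg]
  refine sup_le (sup_le (le_sup_of_le_right ?_) le_sup_left) (le_sup_of_le_right ?_)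
  · refine Submodule.span_le.2 ?_
    rintro _ ⟨⟨i, w⟩, rfl⟩
    exact mem_iSup_eigen (Chevalley.word_f_mem_wtSpace i w) (neg_ne_zero.2 (wordWt_cons_ne_zero i w))
  · refine Submodule.span_le.2 ?_
    rintro _ ⟨⟨i, w⟩, rfl⟩
    exact mem_iSup_eigen (Chevalley.swap_word_mem_wtSpace i w) (wordWt_cons_ne_zero i w)

/-- An ideal intersecting `𝔥` trivially has no component of weight zero. -/
theorem LieIdeal.le_iSup_ne_zero {K : LieIdeal ℂ (SerreAlgebra R)}
    (hK : ∀ x : 𝔥, toSerre R (freeH I x) ∈ K → toSerre R (freeH I x) = 0) :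
    K.toSubmodule ≤ ⨆ ν : {ν // ν ≠ 0}, (serreGen R).ad.wtSpace ν.1 := by
  intro x hx
  have hx' : x ∈ (⊤ : Submodule ℂ (SerreAlgebra R)) := Submodule.mem_top
  rw [← range_h_sup_iSup] at hx'
  obtain ⟨_, ⟨y, rfl⟩, z, hz, rfl⟩ := Submodule.mem_sup.1 hx'
  have h1 : (serreGen R).h y ∈ K.toSubmodule :=
    mem_of_add_mem (LieIdeal.h_mem _ K) ((serreGen R).h_mem_wtSpace_ad y) hz hx
  have h2 : (serreGen R).h y = 0 := hK y h1
  rwa [h2, zero_add]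

/-- Having no weight-zero component passes to sums of ideals. This is how trivial intersection with
𝔥 survives the supremum. -/
theorem radIdeal_le_iSup_ne_zero : (radIdeal R).toSubmodule ≤
    ⨆ ν : {ν // ν ≠ 0}, (serreGen R).ad.wtSpace ν.1 := by
  rw [radIdeal, LieSubmodule.sSup_toSubmodule]
  refine sSup_le ?_
  rintro _ ⟨K, hK, rfl⟩
  exact LieIdeal.le_iSup_ne_zero hK

/-- The largest ideal intersecting `𝔥` trivially does intersect `𝔥` trivially. -/
theorem eq_zero_of_mem_radIdeal {x : 𝔥} (hx : toSerre R (freeH I x) ∈ radIdeal R) :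
    toSerre R (freeH I x) = 0 :=
  eq_zero_of_mem_eigen ((serreGen R).h_mem_wtSpace_ad x) (radIdeal_le_iSup_ne_zero hx)

/-- An ideal of `𝔤(A)` intersecting `𝔥` trivially is zero. -/
theorem LieIdeal.eq_bot_of_h_mem {K : LieIdeal ℂ (KMAlgebra R)}
    (hK : ∀ x : 𝔥, h R x ∈ K → h R x = 0) : K = ⊥ := by
  let K' : LieIdeal ℂ (SerreAlgebra R) := K.comap (quotHom (radIdeal R))
  have hK' : K' ≤ radIdeal R := by
    refine le_sSup fun x hx => ?_
    refine eq_zero_of_mem_radIdeal (quotHom_eq_zero_iff.1 (hK x ?_))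
    exact (LieIdeal.mem_comap).1 hx
  refine (LieSubmodule.eq_bot_iff _).2 fun y hy => ?_
  obtain ⟨x, rfl⟩ := quotHom_surjective _ y
  exact quotHom_eq_zero_iff.2 (hK' (LieIdeal.mem_comap.2 hy))

/-! ### The tester module as a representation of 𝔤(A). -/

section Tester

variable (R) (lam : Module.Dual ℂ 𝔥) (i : I)

/-- The action of `𝔤̄(A)` on `TesterMod`. -/
def serreTester (hA : IsGCM A) : SerreAlgebra R →ₗ⁅ℂ⁆ Module.End ℂ (TesterMod R lam i) :=
  (tester R lam i).serreLift (fun _ _ h => (isTester R lam i).serre_eq_zero hA h)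
    (fun _ _ h => (isTester R lam i).swap_serre_eq_zero hA h)

theorem serreTester_e (hA : IsGCM A) (k : I) :
    serreTester R lam i hA ((serreGen R).e k) = (tester R lam i).e k :=
  Chevalley.freeLift_e _ _

theorem serreTester_f (hA : IsGCM A) (k : I) :
    serreTester R lam i hA ((serreGen R).f k) = (tester R lam i).f k :=
  Chevalley.freeLift_f _ _

theorem serreTester_h (hA : IsGCM A) (x : 𝔥) :
    serreTester R lam i hA ((serreGen R).h x) = (tester R lam i).h x :=
  Chevalley.freeLift_h _ _

/-- Choose λ with λ(α_i^∨) ≠ 0: on the tester module of highest weight λ this element acts on n by a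
nonzero scalar. -/
theorem serreGen_h_coroot_ne_zero (hA : IsGCM A) : (serreGen R).h (R.coroot i) ≠ 0 := by
  intro h0
  obtain ⟨lam, hlam⟩ : ∃ lam : Module.Dual ℂ 𝔥, lam (R.coroot i) ≠ 0 := by
    by_contra! h
    exact R.linearIndependent_coroot.ne_zero i ((Module.forall_dual_apply_eq_zero_iff ℂ _).1 h)
  have ht := isTester R lam i
  have h1 := serreTester_h R lam i hA (R.coroot i)
  rw [h0, map_zero] at h1
  have h2 := ht.mem_wtSpace (R.coroot i)
  simp only at h2
  rw [← h1, LinearMap.zero_apply, eq_comm, smul_eq_zero, or_iff_right hlam] at h2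
  have := ht.φ_self
  rw [h2, map_zero] at this
  exact zero_ne_one this

variable {R}

/-- An ideal of `𝔤̄(A)` intersecting `𝔥` trivially acts by zero on `TesterMod` of highest weight
zero. -/
theorem serreTester_eq_zero (hA : IsGCM A) {K : LieIdeal ℂ (SerreAlgebra R)}
    (hK : ∀ x : 𝔥, toSerre R (freeH I x) ∈ K → toSerre R (freeH I x) = 0) :
    ∀ x ∈ K, serreTester R 0 i hA x = 0 := by
  set s := serreGen R with hs
  set σ := serreTester R 0 i hA with hσ
  set c := tester R 0 i with hc
  set n := testerVec R 0 i with hn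
  set φ := testerφ R 0 i with hφ
  set ψ := testerψ R 0 i with hψ
  have ht : IsTester c 0 i n φ ψ := isTester R 0 i
  have hσe : ∀ k, σ (s.e k) = c.e k := serreTester_e R 0 i hA
  have hσf : ∀ k, σ (s.f k) = c.f k := serreTester_f R 0 i hA
  have hσh : ∀ x, σ (s.h x) = c.h x := serreTester_h R 0 i hA
  -- Highest weight 0 enters here: 𝔥 and all brackets of e's kill n, so only brackets of f's move
  -- it.
  have hhn : ∀ x, σ (s.h x) n = 0 := by
    intro x
    rw [hσh]
    simpa using ht.mem_wtSpace x
  have hpos : ∀ j w, σ (s.swap.ad.word w (s.e j)) n = 0 := by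
    intro j w
    have : s.swap.ad.wordSpan (s.e j) ≤
        LinearMap.ker ((LinearMap.applyₗ n) ∘ₗ (σ : SerreAlgebra R →ₗ[ℂ] Module.End ℂ (TesterMod R 0 i))) := by
      refine Chevalley.wordSpan_le ?_ fun k v hv => ?_
      · change σ (s.e j) n = 0
        rw [hσe, ht.e_apply]
      · change σ ⁅s.e k, v⁆ n = 0
        have hv : σ v n = 0 := hv
        rw [LieHom.map_lie, hσe, Ring.lie_def, LinearMap.sub_apply, Module.End.mul_apply,
          Module.End.mul_apply, hv, ht.e_apply, map_zero, map_zero, sub_zero]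
    exact this (Chevalley.word_mem_wordSpan w _)
  have hφw : ∀ j w v, φ (σ (s.ad.word w (s.f j)) v) = 0 := by
    intro j w
    induction w with
    | nil =>
      intro v
      rw [Chevalley.word_nil, hσf, ht.φ_f]
    | cons k w ih =>
      intro v
      rw [Chevalley.word_cons, Chevalley.ad_f_apply, LieHom.map_lie, hσf, Ring.lie_def,
        LinearMap.sub_apply, Module.End.mul_apply, Module.End.mul_apply, map_sub, ht.φ_f, ih,
        sub_zero]
  -- Brackets of two or more f's have no f_i n-coefficient; only f_i itself can contribute to ψ.
  have hψw : ∀ j k w v, ψ (σ (s.ad.word (k :: w) (s.f j)) v) = 0 := by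
    intro j k w
    have step : ∀ l x, (∀ v, φ (σ x v) = 0) → (∀ v, ψ (σ x (c.f l v)) = 0) →
        ∀ v, ψ (σ ⁅s.f l, x⁆ v) = 0 := by
      intro l x h1 h2 v
      rw [LieHom.map_lie, hσf, Ring.lie_def, LinearMap.sub_apply, Module.End.mul_apply,
        Module.End.mul_apply, map_sub, h2, sub_zero, ht.ψ_f_eq_zero l (h1 v)]
    induction w generalizing k with
    | nil =>
      refine step k _ (hφw j []) fun v => ?_
      rw [Chevalley.word_nil, hσf, ht.ψ_f_eq_zero j (ht.φ_f k v)]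
    | cons l w ih => exact step k _ (hφw j (l :: w)) fun v => ih l _
  have hφK : ∀ x ∈ K, φ (σ x n) = 0 := by
    intro x hx
    let Q : Submodule ℂ (SerreAlgebra R) := (⨆ ν : {ν // ν ≠ 0}, s.ad.wtSpace ν.1) ⊓
      LinearMap.ker (φ ∘ₗ (LinearMap.applyₗ n) ∘ₗ (σ : SerreAlgebra R →ₗ[ℂ] Module.End ℂ (TesterMod R 0 i)))
    have htop : (⊤ : Submodule ℂ (SerreAlgebra R)) ≤ LinearMap.range s.h ⊔ Q := by
      rw [← (generates_serreGen R).neg_sup_range_sup_neg]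
      refine sup_le (sup_le (le_sup_of_le_right ?_) le_sup_left) (le_sup_of_le_right ?_)
      · refine Submodule.span_le.2 ?_
        rintro _ ⟨⟨j, w⟩, rfl⟩
        exact ⟨mem_iSup_eigen (Chevalley.word_f_mem_wtSpace j w)
          (neg_ne_zero.2 (wordWt_cons_ne_zero j w)), hφw j w n⟩
      · refine Submodule.span_le.2 ?_
        rintro _ ⟨⟨j, w⟩, rfl⟩
        refine ⟨mem_iSup_eigen (Chevalley.swap_word_mem_wtSpace j w) (wordWt_cons_ne_zero j w), ?_⟩
        change φ (σ (s.swap.ad.word w (s.e j)) n) = 0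
        rw [hpos, map_zero]
    obtain ⟨_, ⟨y, rfl⟩, z, hz, rfl⟩ := Submodule.mem_sup.1 (htop (Submodule.mem_top (x := x)))
    rw [map_add, LinearMap.add_apply, hhn, zero_add]
    exact hz.2
  have hψK : ∀ x ∈ K, ψ (σ x n) = 0 := by
    intro x hx
    let Q : Submodule ℂ (SerreAlgebra R) :=
      (⨆ ν : {ν // ν ≠ -R.root i}, s.ad.wtSpace ν.1) ⊓
        LinearMap.ker (ψ ∘ₗ (LinearMap.applyₗ n) ∘ₗ (σ : SerreAlgebra R →ₗ[ℂ] Module.End ℂ (TesterMod R 0 i)))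
    have htop : (⊤ : Submodule ℂ (SerreAlgebra R)) ≤ Submodule.span ℂ {s.f i} ⊔ Q := by
      rw [← (generates_serreGen R).neg_sup_range_sup_neg]
      refine sup_le (sup_le ?_ (le_sup_of_le_right ?_)) (le_sup_of_le_right ?_)
      · refine Submodule.span_le.2 ?_
        rintro _ ⟨⟨j, w⟩, rfl⟩
        by_cases hjw : j = i ∧ w = []
        · obtain ⟨rfl, rfl⟩ := hjw
          exact Submodule.mem_sup_left (Submodule.mem_span_singleton_self _)
        · refine Submodule.mem_sup_right
            ⟨mem_iSup_eigen (Chevalley.word_f_mem_wtSpace j w)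
              (fun h => hjw (eq_of_wordWt_cons_eq_root (neg_injective h))), ?_⟩
          change ψ (σ (s.ad.word w (s.f j)) n) = 0
          rcases w with _ | ⟨k, w⟩
          · rw [Chevalley.word_nil, hσf]
            exact ht.ψ_f_ne j n (by simpa using hjw)
          · exact hψw j k w n
      · rintro _ ⟨y, rfl⟩
        refine ⟨mem_iSup_eigen (s.h_mem_wtSpace_ad y) ?_, ?_⟩
        · exact (neg_ne_zero.2 (R.linearIndependent_root.ne_zero i)).symm
        · change ψ (σ (s.h y) n) = 0
          rw [hhn, map_zero]
      · refine Submodule.span_le.2 ?_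
        rintro _ ⟨⟨j, w⟩, rfl⟩
        refine ⟨mem_iSup_eigen (Chevalley.swap_word_mem_wtSpace j w)
          (wordWt_cons_ne_neg_root j i w), ?_⟩
        change ψ (σ (s.swap.ad.word w (s.e j)) n) = 0
        rw [hpos, map_zero]
    obtain ⟨y, hy, z, hz, rfl⟩ := Submodule.mem_sup.1 (htop (Submodule.mem_top (x := x)))
    obtain ⟨a, rfl⟩ := Submodule.mem_span_singleton.1 hy
    -- The component of x in weight -α_i lies in K. Bracketing it with e_i gives a multiple of α_i^∨
    -- in K ∩ 𝔥 = 0, so a = 0.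
    have h1 : a • s.f i ∈ K.toSubmodule := mem_of_add_mem (LieIdeal.h_mem s K)
      (Submodule.smul_mem _ _ (s.f_mem_wtSpace_ad i)) hz.1 hx
    have h2 : ⁅s.e i, a • s.f i⁆ ∈ K := lie_mem_right ℂ _ K _ _ h1
    rw [lie_smul, s.lie_e_f, ← map_smul] at h2
    have h3 := hK _ h2
    have h4 : s.h (a • R.coroot i) = 0 := h3
    rw [map_smul, smul_eq_zero, or_iff_left (serreGen_h_coroot_ne_zero R i hA)] at h4
    rw [h4, zero_smul, zero_add]
    exact hz.2
  intro x hx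
  refine ht.eq_zero_of_forall_mem (X := K.toSubmodule.map (σ : SerreAlgebra R →ₗ[ℂ] Module.End ℂ (TesterMod R 0 i)))
    ?_ ?_ ?_ ?_ (σ x) ⟨x, hx, rfl⟩
  · rintro k _ ⟨y, hy, rfl⟩
    refine ⟨⁅s.e k, y⁆, lie_mem_right ℂ _ K _ _ hy, ?_⟩
    simp [← hσe]
  · rintro k _ ⟨y, hy, rfl⟩
    refine ⟨⁅s.f k, y⁆, lie_mem_right ℂ _ K _ _ hy, ?_⟩
    simp [← hσf]
  · rintro k _ ⟨y, hy, rfl⟩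
    refine ⟨⁅s.h k, y⁆, lie_mem_right ℂ _ K _ _ hy, ?_⟩
    simp [← hσh]
  · rintro _ ⟨y, hy, rfl⟩
    exact ⟨hφK y hy, hψK y hy⟩

variable (R)

/-- The action of `𝔤(A)` on `TesterMod` of highest weight zero. -/
def kmTester (hA : IsGCM A) : KMAlgebra R →ₗ⁅ℂ⁆ Module.End ℂ (TesterMod R 0 i) :=
  quotLift (radIdeal R) (serreTester R 0 i hA) <| by
    have : radIdeal R ≤ (serreTester R 0 i hA).ker :=
      sSup_le fun K hK x hx => (LieHom.mem_ker).2 (serreTester_eq_zero i hA hK x hx)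
    exact fun x hx => LieHom.mem_ker.1 (this hx)

theorem kmTester_e (hA : IsGCM A) (k : I) : kmTester R i hA (e R k) = (tester R 0 i).e k :=
  Chevalley.freeLift_e _ _

theorem kmTester_f (hA : IsGCM A) (k : I) : kmTester R i hA (f R k) = (tester R 0 i).f k :=
  Chevalley.freeLift_f _ _

theorem kmTester_h (hA : IsGCM A) (x : 𝔥) : kmTester R i hA (h R x) = (tester R 0 i).h x :=
  Chevalley.freeLift_h _ _

/-- In `TesterMod` of highest weight zero, the highest weight vector is killed by `f_k`, `k ≠ i`. -/
theorem tester_f_testerVec {k : I} (hk : k ≠ i) : (tester R 0 i).f k (testerVec R 0 i) = 0 := by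
  have ht := isTester R 0 i
  have hw := Chevalley.f_mem_wtSpace ht.mem_wtSpace k
  -- Since α_k^∨ acts on n by 0, the vector f_k n is again singular; the submodule it generates
  -- avoids n, and also f_i n because k ≠ i.
  have he : ∀ l, (tester R 0 i).e l ((tester R 0 i).f k (testerVec R 0 i)) = 0 := by
    intro l
    by_cases hlk : l = k
    · subst hlk
      rw [Chevalley.e_f, ht.e_apply, map_zero, zero_add]
      simpa using ht.mem_wtSpace (R.coroot l)
    · rw [Chevalley.e_f_ne hlk, ht.e_apply, map_zero]
  have h0 := ht.eq_bot ((tester R 0 i).wordSpan ((tester R 0 i).f k (testerVec R 0 i)))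
    (fun l v hv => Chevalley.e_mem_wordSpan hw he hv l)
    (fun l v hv => Chevalley.f_mem_wordSpan hv l)
    (fun x v hv => Chevalley.h_mem_wordSpan hw hv x) fun v hv => by
      have : (tester R 0 i).wordSpan ((tester R 0 i).f k (testerVec R 0 i)) ≤
          LinearMap.ker (testerφ R 0 i) ⊓ LinearMap.ker (testerψ R 0 i) := by
        refine Submodule.span_le.2 ?_
        rintro _ ⟨w, rfl⟩
        exact ht.vanish_word ⟨ht.φ_f _ _, ht.ψ_f_ne k _ hk⟩ w
      exact this hv
  rw [← Submodule.mem_bot ℂ, ← h0]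
  exact Chevalley.self_mem_wordSpan _

end Tester

end Algebra

/-! ### The inequality for generalized Cartan matrices, and chains from steps. -/

section Combinatorics

/-- If `A c ≤ 0` and `l ≤ A d` on the support of `c`, then the indices minimizing `d_i / c_i` form
a set orthogonal to the rest of the support of `d + c`, on which `l` vanishes. -/
theorem IsGCM.exists_orthogonal_subset (hA : IsGCM A) {c d l : I → ℤ} (hc : ∀ k, 0 ≤ c k)
    (hd : ∀ k, 0 ≤ d k) (hc0 : c ≠ 0) (hAc : ∀ i, 0 < c i → ∑ j, A i j * c j ≤ 0)
    (hAd : ∀ i, 0 < c i → l i ≤ ∑ j, A i j * d j) (hl : ∀ i, 0 < c i → 0 ≤ l i) :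
    ∃ Z : Set I, Z.Nonempty ∧ (∀ z ∈ Z, 0 < c z ∧ l z = 0) ∧
      ∀ z ∈ Z, ∀ k ∉ Z, 0 < d k + c k → A z k = 0 := by
  classical
  obtain ⟨j, hj⟩ : ∃ j, 0 < c j := by
    by_contra! h
    exact hc0 (funext fun k => le_antisymm (h k) (hc k))
  obtain ⟨m, hm, hmin⟩ := Finset.exists_min_image (Finset.univ.filter fun k => 0 < c k)
    (fun k => (d k : ℚ) / c k) ⟨j, by simpa using hj⟩
  have hm : 0 < c m := by simpa using hm
  -- With denominators cleared, u_k is d_k / c_k minus the minimal ratio d_m / c_m; thus u ≥ 0, and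
  -- Z is its zero set inside supp c.
  let u : I → ℤ := fun k => d k * c m - d m * c k
  have hu : ∀ k, 0 ≤ u k := by
    intro k
    rcases (hc k).eq_or_lt with h | h
    · simp only [u, ← h, mul_zero, sub_zero]
      exact mul_nonneg (hd k) hm.le
    · have h1 := hmin k (by simpa using h)
      rw [div_le_div_iff₀ (by exact_mod_cast hm) (by exact_mod_cast h)] at h1
      have h2 : d m * c k ≤ d k * c m := by exact_mod_cast h1
      exact sub_nonneg.2 h2
  -- Row z of Au is a sum of nonpositive terms, the diagonal one being 0. It also equals c_m (Ad)_z
  -- - d_m (Ac)_z ≥ c_m l_z ≥ 0, so every inequality is an equality.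
  have key : ∀ z, 0 < c z → u z = 0 → l z = 0 ∧ ∀ k, A z k * u k = 0 := by
    intro z hz huz
    have hterm : ∀ k ∈ Finset.univ, A z k * u k ≤ 0 := by
      intro k _
      by_cases hzk : z = k
      · rw [← hzk, huz, mul_zero]
      · exact mul_nonpos_of_nonpos_of_nonneg (hA.nonpos z k hzk) (hu k)
    have hsum : ∑ k, A z k * u k = c m * ∑ k, A z k * d k - d m * ∑ k, A z k * c k := by
      rw [Finset.mul_sum, Finset.mul_sum, ← Finset.sum_sub_distrib]
      refine Finset.sum_congr rfl fun k _ => ?_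
      simp only [u]
      ring
    have h1 : c m * l z ≤ c m * ∑ k, A z k * d k := mul_le_mul_of_nonneg_left (hAd z hz) hm.le
    have h2 : d m * ∑ k, A z k * c k ≤ 0 := mul_nonpos_of_nonneg_of_nonpos (hd m) (hAc z hz)
    have h3 : 0 ≤ c m * l z := mul_nonneg hm.le (hl z hz)
    have h4 : ∑ k, A z k * u k ≤ 0 := Finset.sum_nonpos hterm
    have h5 : ∑ k, A z k * u k = 0 := by omega
    refine ⟨?_, fun k => (Finset.sum_eq_zero_iff_of_nonpos hterm).1 h5 k (Finset.mem_univ k)⟩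
    have h6 : c m * l z = 0 := by omega
    exact (mul_eq_zero.1 h6).resolve_left hm.ne'
  refine ⟨{z | 0 < c z ∧ u z = 0}, ⟨m, hm, by simp [u, mul_comm]⟩,
    fun z hz => ⟨hz.1, (key z hz.1 hz.2).1⟩, fun z hz k hk hdk => ?_⟩
  have huk : u k ≠ 0 := by
    rcases (hc k).eq_or_lt with h | h
    · have : 0 < d k := by omega
      simp only [u, ← h, mul_zero, sub_zero]
      exact mul_ne_zero this.ne' hm.ne'
    · exact fun h' => hk ⟨h, h'⟩
  exact (mul_eq_zero.1 ((key z hz.1 hz.2).2 k)).resolve_right huk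

variable (R) in
/-- One of two different comparable elements of `S` can be moved towards the other. -/
def HasStep (S : Set (Module.Dual ℂ 𝔥)) : Prop :=
  ∀ μ₀ ∈ S, ∀ c : I → ℤ, (∀ k, 0 ≤ c k) → c ≠ 0 → μ₀ + rt R c ∈ S →
    ∃ i, 0 < c i ∧ (μ₀ + R.root i ∈ S ∨ μ₀ + rt R c - R.root i ∈ S)

/-- Each step lowers the height of the gap by one; the chain for the smaller gap is extended at
whichever end was moved. -/
theorem HasStep.exists_chain {S : Set (Module.Dual ℂ 𝔥)} (hS : HasStep R S) (n : ℕ) :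
    ∀ μ₀ ∈ S, ∀ c : I → ℤ, (∀ k, 0 ≤ c k) → ∑ k, c k = n → μ₀ + rt R c ∈ S →
      ∃ ν : ℕ → Module.Dual ℂ 𝔥, ν 0 = μ₀ ∧ ν n = μ₀ + rt R c ∧ (∀ k ≤ n, ν k ∈ S) ∧
        ∀ k < n, ν (k + 1) - ν k ∈ Set.range R.root := by
  classical
  induction n with
  | zero =>
    intro μ₀ hμ₀ c hc hsum _
    have : c = 0 := funext fun k =>
      (Finset.sum_eq_zero_iff_of_nonneg fun k _ => hc k).1 hsum k (Finset.mem_univ k)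
    subst this
    exact ⟨fun _ => μ₀, rfl, by simp, fun _ _ => hμ₀, by simp⟩
  | succ n ih =>
    intro μ₀ hμ₀ c hc hsum hμ
    have hc0 : c ≠ 0 := by
      rintro rfl
      simp at hsum
      omega
    obtain ⟨i, hi, hstep⟩ := hS μ₀ hμ₀ c hc hc0 hμ
    let c' : I → ℤ := c - Pi.single i 1
    have hc' : ∀ k, 0 ≤ c' k := by
      intro k
      by_cases hk : k = i
      · subst hk
        simp [c']
        omega
      · simp [c', hk, hc k]
    have hsum' : ∑ k, c' k = n := by
      simp [c', hsum]
    have hrt : rt R c' = rt R c - R.root i := by rw [map_sub, rt_single]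
    rcases hstep with h | h
    · obtain ⟨ν, h0, hn, hmem, hdiff⟩ := ih _ h c' hc' hsum' (by
        rw [hrt]
        convert hμ using 1
        abel)
      refine ⟨fun k => Nat.casesOn k μ₀ ν, rfl, ?_, ?_, ?_⟩
      · change ν n = _
        rw [hn, hrt]
        abel
      · rintro (_ | k) hk
        · exact hμ₀
        · exact hmem k (by omega)
      · rintro (_ | k) hk
        · exact ⟨i, by change _ = ν 0 - μ₀; rw [h0]; abel⟩
        · exact hdiff k (by omega)
    · obtain ⟨ν, h0, hn, hmem, hdiff⟩ := ih _ hμ₀ c' hc' hsum' (by rwa [hrt, ← add_sub_assoc])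
      refine ⟨fun k => if k ≤ n then ν k else μ₀ + rt R c, by simp [h0], by simp, ?_, ?_⟩
      · intro k _
        by_cases hk : k ≤ n
        · simp [hk, hmem k hk]
        · simp [hk, hμ]
      · intro k hk
        rcases (Nat.lt_succ_iff.1 hk).eq_or_lt with h' | h'
        · subst h'
          refine ⟨i, ?_⟩
          simp [hn, hrt]
        · have h1 : k + 1 ≤ n := h'
          simpa [h1, h'.le] using hdiff k h'

theorem exists_rt_of_prec {μ₀ μ : Module.Dual ℂ 𝔥} (h : Prec R μ₀ μ) :
    ∃ c : I → ℤ, (∀ k, 0 ≤ c k) ∧ μ - μ₀ = rt R c := by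
  classical
  have h : μ - μ₀ ∈ AddSubmonoid.closure (Set.range R.root) := h
  generalize μ - μ₀ = x at h
  induction h using AddSubmonoid.closure_induction with
  | mem x hx =>
    obtain ⟨i, rfl⟩ := hx
    refine ⟨Pi.single i 1, fun k => ?_, (rt_single i).symm⟩
    by_cases hk : k = i
    · subst hk; simp
    · simp [hk]
  | zero => exact ⟨0, by simp, by simp⟩
  | add x y _ _ hx hy =>
    obtain ⟨c, hc, rfl⟩ := hx
    obtain ⟨d, hd, rfl⟩ := hy
    exact ⟨c + d, fun k => add_nonneg (hc k) (hd k), (map_add _ _ _).symm⟩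

theorem height_rt (c : I → ℤ) : height R (rt R c) = ∑ k, (c k : ℂ) := by
  have hx : rt R c ∈ Submodule.span ℂ (Set.range R.root) :=
    Submodule.sum_mem _ fun k _ => Submodule.smul_mem _ _ (Submodule.subset_span ⟨k, rfl⟩)
  rw [height, dif_pos hx]
  have : R.linearIndependent_root.repr ⟨rt R c, hx⟩
      = (Finsupp.linearEquivFunOnFinite ℂ ℂ I).symm fun k => (c k : ℂ) := by
    refine R.linearIndependent_root.repr_eq ?_
    rw [Finsupp.linearCombination_eq_fintype_linearCombination_apply ℂ]
    rfl
  rw [this]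
  rfl

theorem HasStep.hasSimpleChain {S : Set (Module.Dual ℂ 𝔥)} (hS : HasStep R S)
    {μ₀ μ : Module.Dual ℂ 𝔥} (hμ₀ : μ₀ ∈ S) (hμ : μ ∈ S) (h : Prec R μ₀ μ) :
    HasSimpleChain R S μ₀ μ := by
  obtain ⟨c, hc, hcμ⟩ := exists_rt_of_prec h
  have hμc : μ = μ₀ + rt R c := by rw [← hcμ]; abel
  obtain ⟨n, hn⟩ := Int.eq_ofNat_of_zero_le (Finset.sum_nonneg fun k (_ : k ∈ Finset.univ) => hc k)
  obtain ⟨ν, h0, h1, h2, h3⟩ := hS.exists_chain n μ₀ hμ₀ c hc hn (hμc ▸ hμ)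
  refine ⟨n, fun k => ν k, ?_, h0, by simpa [hμc] using h1, fun k => h2 k (by omega), fun k => ?_⟩
  · rw [hcμ, height_rt]
    exact_mod_cast hn.symm
  · exact h3 k k.2

end Combinatorics

/-! ### Weights of modules over 𝔤(A). -/

section Weights

variable {M : Type*} [AddCommGroup M] [Module ℂ M] [LieRingModule (KMAlgebra R) M]
  [LieModule ℂ (KMAlgebra R) M]

variable (R M) in
/-- The Chevalley generators of `𝔤(A)` acting on a module. -/
def kmAct : Chevalley R (Module.End ℂ M) := (kmGen R).map (LieModule.toEnd ℂ (KMAlgebra R) M)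

@[simp] theorem kmAct_f (i : I) (v : M) : (kmAct R M).f i v = ⁅f R i, v⁆ := rfl
@[simp] theorem kmAct_h (x : 𝔥) (v : M) : (kmAct R M).h x v = ⁅h R x, v⁆ := rfl

theorem mem_wt_iff {μ : Module.Dual ℂ 𝔥} :
    μ ∈ wt R M ↔ ∃ v ∈ (kmAct R M).wtSpace μ, v ≠ 0 :=
  (Submodule.ne_bot_iff _)

theorem mem_wt {μ : Module.Dual ℂ 𝔥} {v : M} (hv : v ∈ (kmAct R M).wtSpace μ) (hv0 : v ≠ 0) :
    μ ∈ wt R M :=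
  mem_wt_iff.2 ⟨v, hv, hv0⟩

theorem lie_e_eq_zero {μ : Module.Dual ℂ 𝔥} {v : M} (hv : v ∈ (kmAct R M).wtSpace μ) {i : I}
    (h : μ + R.root i ∉ wt R M) : ⁅e R i, v⁆ = 0 := by
  by_contra h0
  exact h (mem_wt (Chevalley.e_mem_wtSpace hv i) h0)

theorem lie_f_eq_zero {μ : Module.Dual ℂ 𝔥} {v : M} (hv : v ∈ (kmAct R M).wtSpace μ) {i : I}
    (h : μ - R.root i ∉ wt R M) : ⁅f R i, v⁆ = 0 := by
  by_contra h0
  exact h (mem_wt (Chevalley.f_mem_wtSpace hv i) h0)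

theorem Chevalley.Generates.lie_mem {𝔏 : Type*} [LieRing 𝔏] [LieAlgebra ℂ 𝔏] {c : Chevalley R 𝔏}
    (hc : c.Generates) {V : Type*} [AddCommGroup V] [Module ℂ V] [LieRingModule 𝔏 V]
    [LieModule ℂ 𝔏 V] {W : Submodule ℂ V} (hE : ∀ i, ∀ v ∈ W, ⁅c.e i, v⁆ ∈ W)
    (hF : ∀ i, ∀ v ∈ W, ⁅c.f i, v⁆ ∈ W) (hH : ∀ x, ∀ v ∈ W, ⁅c.h x, v⁆ ∈ W) (x : 𝔏) {v : V}
    (hv : v ∈ W) : ⁅x, v⁆ ∈ W := by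
  let K : LieSubalgebra ℂ 𝔏 :=
    { carrier := {x | ∀ y ∈ W, ⁅x, y⁆ ∈ W}
      zero_mem' := fun y _ => by simp
      add_mem' := fun {a b} ha hb y hy => by
        rw [add_lie]
        exact add_mem (ha y hy) (hb y hy)
      smul_mem' := fun r a ha y hy => by
        rw [smul_lie]
        exact Submodule.smul_mem _ _ (ha y hy)
      lie_mem' := fun {a b} ha hb y hy => by
        rw [lie_lie]
        exact sub_mem (ha _ (hb y hy)) (hb _ (ha y hy)) }
  have hK : K = ⊤ := hc K hE hF hH
  exact (hK ▸ LieSubalgebra.mem_top x : x ∈ K) v hv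

theorem Chevalley.Generates.swap_pow_ad {𝔏 : Type*} [LieRing 𝔏] [LieAlgebra ℂ 𝔏]
    {c : Chevalley R 𝔏} (hc : c.Generates) (h : ∀ i j, i ≠ j → c.swap.serre i j = 0) (i : I)
    (x : 𝔏) : ∃ n, ((LieAlgebra.ad ℂ 𝔏 (c.e i)) ^ n) x = 0 :=
  hc.swap.exists_pow_ad_f_eq_zero h i x

variable (R) in
theorem exists_pow_ad_f (i : I) (x : KMAlgebra R) :
    ∃ n, ((LieAlgebra.ad ℂ (KMAlgebra R) (f R i)) ^ n) x = 0 :=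
  (generates_kmGen R).exists_pow_ad_f_eq_zero (fun _ _ => kmGen_serre R) i x

variable (R) in
theorem exists_pow_ad_e (i : I) (x : KMAlgebra R) :
    ∃ n, ((LieAlgebra.ad ℂ (KMAlgebra R) (e R i)) ^ n) x = 0 :=
  (generates_kmGen R).swap_pow_ad (fun _ _ => kmGen_swap_serre R) i x

end Weights

/-! ### The adjoint representation. -/

section Adjoint

/-- A vector of positive weight killed by all the `f_i` is zero. -/
theorem exists_lie_f_ne_zero {q : I → ℤ} (hq : ∀ k, 0 ≤ q k) (hq0 : q ≠ 0) {x : KMAlgebra R}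
    (hx : x ∈ (kmGen R).ad.wtSpace (rt R q)) (hx0 : x ≠ 0) : ∃ i, ⁅f R i, x⁆ ≠ 0 := by
  by_contra! hf
  -- After the swap x is a singular vector, so words in the e_i applied to x span an ideal. All its
  -- weights are positive, so it meets 𝔥 trivially and vanishes in 𝔤(A).
  set c := (kmGen R).swap with hc
  have hx' : x ∈ c.ad.wtSpace (-rt R q) := by
    rw [hc, Chevalley.swap_wtSpace_ad, neg_neg]
    exact hx
  let Y := c.ad.wordSpan x
  let K : LieIdeal ℂ (KMAlgebra R) :=
    { Y with
      lie_mem := fun {y v} hv => (generates_kmGen R).swap.lie_mem (W := Y)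
        (fun i v hv => Chevalley.e_mem_wordSpan hx' hf hv i)
        (fun i v hv => Chevalley.f_mem_wordSpan hv i)
        (fun t v hv => Chevalley.h_mem_wordSpan hx' hv t) y hv }
  have hK : K = ⊥ := by
    refine LieIdeal.eq_bot_of_h_mem fun y hy => ?_
    have hY : Y ≤ ⨆ ν : {ν // ν ≠ 0}, (kmGen R).ad.wtSpace ν.1 := by
      refine Submodule.span_le.2 ?_
      rintro _ ⟨w, rfl⟩
      have h1 := Chevalley.word_mem_wtSpace hx' w
      rw [hc, Chevalley.swap_wtSpace_ad] at h1
      refine mem_iSup_eigen h1 ?_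
      rw [wordWt_eq_rt, ← map_neg, ← map_sub, ← map_neg, ← map_zero (rt R), rt_injective.ne_iff]
      intro h0
      obtain ⟨k, hk⟩ : ∃ k, 0 < q k := by
        by_contra! h
        exact hq0 (funext fun k => le_antisymm (h k) (hq k))
      have h2 := congrFun h0 k
      have h3 := cnt_nonneg w k
      simp only [Pi.neg_apply, Pi.sub_apply, Pi.zero_apply] at h2
      omega
    exact eq_zero_of_mem_eigen ((kmGen R).h_mem_wtSpace_ad y) (hY hy)
  have hxK : x ∈ K := Chevalley.self_mem_wordSpan x
  rw [hK] at hxK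
  exact hx0 ((LieSubmodule.mem_bot x).1 hxK)

/-- The weights of the adjoint representation. -/
theorem exists_word_of_mem_wt {μ : Module.Dual ℂ 𝔥} (hμ : μ ∈ wt R (KMAlgebra R)) :
    μ = 0 ∨ (∃ i w, wordWt R (i :: w) = μ ∧ (kmGen R).swap.ad.word w (e R i) ≠ 0) ∨
      ∃ i w, -wordWt R (i :: w) = μ := by
  obtain ⟨x, hx, hx0⟩ := mem_wt_iff.1 hμ
  let b : (I × List I) ⊕ 𝔥 ⊕ (I × List I) → KMAlgebra R :=
    Sum.elim (fun p => (kmGen R).ad.word p.2 (f R p.1))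
      (Sum.elim (h R) fun p => (kmGen R).swap.ad.word p.2 (e R p.1))
  let wt' : (I × List I) ⊕ 𝔥 ⊕ (I × List I) → Module.Dual ℂ 𝔥 :=
    Sum.elim (fun p => -wordWt R (p.1 :: p.2))
      (Sum.elim (fun _ => 0) fun p => wordWt R (p.1 :: p.2))
  have hb : ∀ s, b s ∈ (kmGen R).ad.wtSpace (wt' s) := by
    rintro (⟨i, w⟩ | y | ⟨i, w⟩)
    · exact Chevalley.word_f_mem_wtSpace i w
    · exact (kmGen R).h_mem_wtSpace_ad y
    · exact Chevalley.swap_word_mem_wtSpace i w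
  have hspan : Submodule.span ℂ (Set.range b) = ⊤ := by
    rw [Set.Sum.elim_range, Set.Sum.elim_range, Submodule.span_union, Submodule.span_union,
      ← (generates_kmGen R).neg_sup_range_sup_neg, ← sup_assoc]
    congr 2
    exact Submodule.span_eq (LinearMap.range (kmGen R).h)
  obtain ⟨s, hs, hs0⟩ := exists_of_span hb hx hx0 (hspan ▸ Submodule.mem_top)
  rcases s with ⟨i, w⟩ | y | ⟨i, w⟩
  · exact Or.inr (Or.inr ⟨i, w, hs⟩)
  · exact Or.inl hs.symm
  · exact Or.inr (Or.inl ⟨i, w, hs, hs0⟩)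

theorem exists_rt_of_mem_wt {μ : Module.Dual ℂ 𝔥} (hμ : μ ∈ wt R (KMAlgebra R)) :
    ∃ q : I → ℤ, rt R q = μ ∧ ((∀ k, 0 ≤ q k) ∨ ∀ k, q k ≤ 0) := by
  rcases exists_word_of_mem_wt hμ with rfl | ⟨i, w, rfl, -⟩ | ⟨i, w, rfl⟩
  · exact ⟨0, map_zero _, Or.inl fun _ => le_rfl⟩
  · exact ⟨_, (wordWt_eq_rt _).symm, Or.inl (cnt_nonneg _)⟩
  · refine ⟨-cnt (i :: w), ?_, Or.inr fun k => ?_⟩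
    · rw [map_neg, wordWt_eq_rt]
    · exact neg_nonpos.2 (cnt_nonneg _ k)

theorem Chevalley.lie_word_eq_zero {𝔏 : Type*} [LieRing 𝔏] [LieAlgebra ℂ 𝔏] {c : Chevalley R 𝔏}
    {a : 𝔏} {i : I} {w : List I} (h : ∀ k ∈ i :: w, ⁅a, c.f k⁆ = 0) :
    ⁅a, c.ad.word w (c.f i)⁆ = 0 := by
  induction w with
  | nil => exact h i (by simp)
  | cons j w ih =>
    rw [Chevalley.word_cons, Chevalley.ad_f_apply, leibniz_lie, h j (by simp), zero_lie, zero_add,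
      ih fun k hk => h k (by simp at hk ⊢; tauto), lie_zero]

/-- The letters of a nonzero iterated bracket are connected. -/
theorem Chevalley.word_connected {𝔏 : Type*} [LieRing 𝔏] [LieAlgebra ℂ 𝔏] {c : Chevalley R 𝔏}
    {Z : Set I} {i : I} {w : List I}
    (hZ : ∀ z ∈ Z, ∀ k ∉ Z, k ∈ i :: w → ⁅c.f z, c.f k⁆ = 0) (h : c.ad.word w (c.f i) ≠ 0) :
    (∀ k ∈ i :: w, k ∈ Z) ∨ ∀ k ∈ i :: w, k ∉ Z := by
  induction w with
  | nil => by_cases hi : i ∈ Z <;> simp [hi]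
  | cons j w ih =>
    have h' : c.ad.word w (c.f i) ≠ 0 := by
      intro h0
      rw [Chevalley.word_cons, h0, map_zero] at h
      exact h rfl
    rcases ih (fun z hz k hk hkw => hZ z hz k hk (by simp at hkw ⊢; tauto)) h' with hw | hw
    · by_cases hj : j ∈ Z
      · left
        simpa [hj] using hw
      · refine absurd (Chevalley.lie_word_eq_zero fun k hk => ?_) h
        rw [← lie_skew, hZ k (hw k hk) j hj (by simp), neg_zero]
    · by_cases hj : j ∈ Z
      · refine absurd (Chevalley.lie_word_eq_zero fun k hk => ?_) h
        exact hZ j hj k (hw k hk) (by simp at hk ⊢; tauto)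
      · right
        simpa [hj] using hw

theorem Chevalley.lie_f_f_eq_zero {𝔏 : Type*} [LieRing 𝔏] [LieAlgebra ℂ 𝔏] {c : Chevalley R 𝔏}
    (hs : ∀ i j, i ≠ j → c.serre i j = 0) {i j : I} (hij : i ≠ j) (h : A i j = 0) :
    ⁅c.f i, c.f j⁆ = 0 := by
  have := hs i j hij
  rw [Chevalley.serre, h] at this
  simpa using this

/-- If μ₀ ≤ 0, any f_i not killing a vector of weight μ works, since q_i > 0 forces c_i > 0. If μ₀ ≥
0, the orthogonal set Z contradicts connectedness of the support of μ. -/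
theorem exists_step_of_pos (hA : IsGCM A) {μ₀ : Module.Dual ℂ 𝔥}
    (hμ₀ : μ₀ ∈ wt R (KMAlgebra R)) {c q : I → ℤ} (hc : ∀ k, 0 ≤ c k) (hc0 : c ≠ 0)
    (hμ : rt R q ∈ wt R (KMAlgebra R)) (hq : μ₀ + rt R c = rt R q) (hq1 : ∀ k, 0 ≤ q k)
    (hq0 : q ≠ 0) :
    ∃ i, 0 < c i ∧ (μ₀ + R.root i ∈ wt R (KMAlgebra R) ∨
      rt R q - R.root i ∈ wt R (KMAlgebra R)) := by
  classical
  obtain ⟨p, rfl, hp⟩ := exists_rt_of_mem_wt hμ₀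
  rw [← map_add, rt_injective.eq_iff] at hq
  subst hq
  obtain ⟨x, hx, hx0⟩ := mem_wt_iff.1 hμ
  obtain ⟨i, hi⟩ := exists_lie_f_ne_zero hq1 hq0 hx hx0
  have hiμ : rt R (p + c) - R.root i ∈ wt R (KMAlgebra R) :=
    mem_wt (Chevalley.f_mem_wtSpace hx i) hi
  -- Weights have coefficients of one sign, so μ - α_i cannot be a weight if μ > 0 does not involve
  -- α_i.
  have hqi : 0 < (p + c) i := by
    obtain ⟨r, hr, hr'⟩ := exists_rt_of_mem_wt hiμ
    rw [← rt_single, ← map_sub, rt_injective.eq_iff] at hr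
    subst hr
    rcases hr' with h | h
    · have := h i
      simp at this ⊢
      omega
    · by_contra h0
      refine hq0 (funext fun k => le_antisymm ?_ (hq1 k))
      by_cases hk : k = i
      · subst hk
        exact not_lt.1 h0
      · have := h k
        simpa [hk] using this
  rcases hp with hp | hp
  · by_contra! hstuck
    obtain ⟨x₀, hx₀, hx₀0⟩ := mem_wt_iff.1 hμ₀
    have h1 : ∀ i, 0 < c i → 0 ≤ ∑ j, A i j * p j := by
      intro i hi
      obtain ⟨n, hn⟩ := Chevalley.exists_nat_of_pow_f_eq_zero (c := (kmGen R).ad) hA hx₀0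
        (hx₀ (R.coroot i)) (lie_e_eq_zero hx₀ (hstuck i hi).1) (exists_pow_ad_f R i x₀)
      rw [rt_apply_coroot] at hn
      have : ∑ j, A i j * p j = n := by exact_mod_cast hn
      omega
    have h2 : ∀ i, 0 < c i → ∑ j, A i j * (p + c) j ≤ 0 := by
      intro i hi
      obtain ⟨n, hn⟩ := Chevalley.exists_nat_of_pow_e_eq_zero (c := (kmGen R).ad) hA hx0
        (hx (R.coroot i)) (lie_f_eq_zero hx (hstuck i hi).2) (exists_pow_ad_e R i x)
      rw [rt_apply_coroot] at hn
      have : ∑ j, A i j * (p + c) j = -n := by exact_mod_cast hn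
      omega
    obtain ⟨Z, ⟨z, hz⟩, hZc, hZ⟩ := hA.exists_orthogonal_subset (c := c) (d := p) (l := 0) hc hp hc0
      (fun i hi => by
        have h3 := h1 i hi
        have h4 := h2 i hi
        simp only [Pi.add_apply, mul_add, Finset.sum_add_distrib] at h4
        omega) h1 (fun _ _ => le_rfl)
    rcases exists_word_of_mem_wt hμ with h | ⟨j, w, hw, hw0⟩ | ⟨j, w, hw⟩
    · rw [← map_zero (rt R), rt_injective.eq_iff] at h
      exact hq0 h
    · rw [wordWt_eq_rt, rt_injective.eq_iff] at hw
      have hmem : ∀ k, k ∈ j :: w ↔ 0 < p k + c k := by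
        intro k
        rw [← cnt_pos_iff, hw, Pi.add_apply]
      -- The letters of a nonzero bracket of weight μ are exactly supp μ. If all lie in Z ⊆ supp c,
      -- then so does i, and μ - α_i is a step; they cannot all avoid Z, as Z is nonempty and inside
      -- supp μ.
      rcases Chevalley.word_connected (c := (kmGen R).swap) (Z := Z) (i := j) (w := w)
        (fun z hz k hk hkw => Chevalley.lie_f_f_eq_zero (fun _ _ => kmGen_swap_serre R)
          (by rintro rfl; exact hk hz) (hZ z hz k hk ((hmem k).1 hkw))) hw0 with h | h
      · exact (hstuck i (hZc i (h i ((hmem i).2 hqi))).1).2 hiμ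
      · exact h z ((hmem z).2 (by have := (hZc z hz).1; have := hp z; omega)) hz
    · rw [wordWt_eq_rt, ← map_neg, rt_injective.eq_iff] at hw
      refine hq0 (funext fun k => le_antisymm ?_ (hq1 k))
      rw [← hw]
      exact neg_nonpos.2 (cnt_nonneg _ k)
  · refine ⟨i, ?_, Or.inr hiμ⟩
    have := hp i
    simp at hqi
    omega

variable (R) in
/-- The involution of `𝔤̄(A)` exchanging `e_i` and `f_i`. -/
def serreInv : SerreAlgebra R →ₗ⁅ℂ⁆ SerreAlgebra R :=
  (serreGen R).swap.serreLift (fun _ _ => serreGen_swap_serre R)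
    (fun _ _ hij => serreGen_serre R hij)

theorem serreInv_e (i : I) : serreInv R ((serreGen R).e i) = (serreGen R).f i :=
  Chevalley.freeLift_e _ _

theorem serreInv_f (i : I) : serreInv R ((serreGen R).f i) = (serreGen R).e i :=
  Chevalley.freeLift_f _ _

theorem serreInv_h (x : 𝔥) : serreInv R ((serreGen R).h x) = -(serreGen R).h x :=
  Chevalley.freeLift_h _ _

theorem serreInv_serreInv (x : SerreAlgebra R) : serreInv R (serreInv R x) = x := by
  let K : LieSubalgebra ℂ (SerreAlgebra R) :=
    { carrier := {x | serreInv R (serreInv R x) = x}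
      zero_mem' := by simp
      add_mem' := fun {a b} ha hb => by
        simp only [Set.mem_ofPred_eq] at ha hb ⊢
        rw [map_add, map_add, ha, hb]
      smul_mem' := fun r a ha => by
        simp only [Set.mem_ofPred_eq] at ha ⊢
        rw [map_smul, map_smul, ha]
      lie_mem' := fun {a b} ha hb => by
        change serreInv R (serreInv R a) = a at ha
        change serreInv R (serreInv R b) = b at hb
        change serreInv R (serreInv R ⁅a, b⁆) = ⁅a, b⁆
        rw [LieHom.map_lie, LieHom.map_lie, ha, hb] }
  have hK : K = ⊤ := by
    refine generates_serreGen R K (fun i => ?_) (fun i => ?_) fun x => ?_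
    · change serreInv R (serreInv R _) = _
      rw [serreInv_e, serreInv_f]
    · change serreInv R (serreInv R _) = _
      rw [serreInv_f, serreInv_e]
    · change serreInv R (serreInv R _) = _
      rw [serreInv_h, map_neg, serreInv_h, neg_neg]
  exact (hK ▸ LieSubalgebra.mem_top x : x ∈ K)

theorem serreInv_mem_radIdeal {x : SerreAlgebra R} (hx : x ∈ radIdeal R) :
    serreInv R x ∈ radIdeal R := by
  have : radIdeal R ≤ (radIdeal R).comap (serreInv R) := by
    refine sSup_le fun K hK y hy => ?_
    -- The involution acts on 𝔥 by -1, so the preimage of an ideal missing 𝔥 also misses 𝔥.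
    have h1 : K.comap (serreInv R) ≤ radIdeal R := by
      refine le_sSup fun t ht => ?_
      have h2 : serreInv R ((serreGen R).h t) ∈ K := LieIdeal.mem_comap.1 ht
      rw [serreInv_h] at h2
      exact hK t (neg_mem_iff.1 h2)
    refine LieIdeal.mem_comap.2 (h1 (LieIdeal.mem_comap.2 ?_))
    rwa [serreInv_serreInv]
  exact LieIdeal.mem_comap.1 (this hx)

theorem neg_mem_wt {μ : Module.Dual ℂ 𝔥} (hμ : μ ∈ wt R (KMAlgebra R)) :
    -μ ∈ wt R (KMAlgebra R) := by
  let ω : KMAlgebra R →ₗ⁅ℂ⁆ KMAlgebra R :=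
    quotLift (radIdeal R) ((quotHom (radIdeal R)).comp (serreInv R))
      fun x hx => quotHom_eq_zero_iff.2 (serreInv_mem_radIdeal hx)
  have hω : ∀ x, ω (ω x) = x := by
    intro x
    obtain ⟨x, rfl⟩ := quotHom_surjective _ x
    exact congrArg (quotHom (radIdeal R)) (serreInv_serreInv x)
  have hωh : ∀ x, ω (h R x) = -h R x := by
    intro x
    exact (congrArg (quotHom (radIdeal R)) (serreInv_h x)).trans (map_neg _ _)
  obtain ⟨x, hx, hx0⟩ := mem_wt_iff.1 hμ
  refine mem_wt (v := ω x) (fun y => ?_) fun h0 => hx0 ?_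
  · have h1 := congrArg ω (hx y)
    simp only [kmAct_h, LieHom.map_lie, hωh, neg_lie, map_smul] at h1 ⊢
    rw [LinearMap.neg_apply, neg_smul, ← h1, neg_neg]
  · rw [← hω x, h0, map_zero]

/-- When μ ≤ 0, negation exchanges the two ends: -μ lies below -μ₀, which is nonnegative, and
nonzero because c ≠ 0. -/
theorem hasStep_adjoint (hA : IsGCM A) : HasStep R (wt R (KMAlgebra R)) := by
  intro μ₀ hμ₀ c hc hc0 hμ
  obtain ⟨q, hq, hq'⟩ := exists_rt_of_mem_wt hμ
  have hneg : (∀ k, q k ≤ 0) → ∃ i, 0 < c i ∧ (μ₀ + R.root i ∈ wt R (KMAlgebra R) ∨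
      μ₀ + rt R c - R.root i ∈ wt R (KMAlgebra R)) := by
    intro hq1
    have h0 : rt R (c - q) = -μ₀ := by rw [map_sub, hq]; abel
    obtain ⟨i, hi, h⟩ := exists_step_of_pos hA (neg_mem_wt hμ) (c := c) (q := c - q) hc hc0
      (h0 ▸ neg_mem_wt hμ₀) (by rw [h0]; abel) (fun k => sub_nonneg.2 ((hq1 k).trans (hc k))) (by
        intro h
        refine hc0 (funext fun k => le_antisymm ?_ (hc k))
        have := congrFun h k
        simp only [Pi.sub_apply, Pi.zero_apply] at this ⊢
        have := hq1 k
        omega)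
    refine ⟨i, hi, ?_⟩
    rcases h with h | h
    · right
      convert neg_mem_wt h using 1
      abel
    · left
      rw [h0] at h
      convert neg_mem_wt h using 1
      abel
  rcases hq' with hq1 | hq1
  · by_cases hq0 : q = 0
    · exact hneg fun k => by simp [hq0]
    · obtain ⟨i, hi, h⟩ := exists_step_of_pos hA hμ₀ hc hc0 (hq ▸ hμ) hq.symm hq1 hq0
      exact ⟨i, hi, hq ▸ h⟩
  · exact hneg hq1

end Adjoint

/-! ### Enveloping algebras and tensor products of representations. -/

section Enveloping

variable {L : Type*} [LieRing L] [LieAlgebra ℂ L]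

theorem enveloping_eq_top_of_ι_mem
    {S : Subalgebra ℂ (UniversalEnvelopingAlgebra ℂ L)}
    (h : ∀ x : L, UniversalEnvelopingAlgebra.ι ℂ x ∈ S) : S = ⊤ := by
  let g : L →ₗ⁅ℂ⁆ S :=
    { toFun := fun x => ⟨UniversalEnvelopingAlgebra.ι ℂ x, h x⟩
      map_add' := fun x y => Subtype.ext (map_add _ x y)
      map_smul' := fun a x => Subtype.ext (map_smul _ a x)
      map_lie' := fun {x y} => Subtype.ext (LieHom.map_lie _ x y) }
  have hg : S.val.comp (UniversalEnvelopingAlgebra.lift ℂ g) = AlgHom.id ℂ _ := by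
    refine UniversalEnvelopingAlgebra.hom_ext ℂ (LieHom.ext fun x => ?_)
    change S.val (UniversalEnvelopingAlgebra.lift ℂ g (UniversalEnvelopingAlgebra.ι ℂ x)) = _
    rw [UniversalEnvelopingAlgebra.lift_ι_apply]
    rfl
  rw [eq_top_iff]
  intro u _
  have := AlgHom.congr_fun hg u
  rw [AlgHom.id_apply] at this
  rw [← this]
  exact (UniversalEnvelopingAlgebra.lift ℂ g u).2

/-- The tensor product of two representations. -/
def tensorRep {M N : Type*} [AddCommGroup M] [Module ℂ M] [AddCommGroup N] [Module ℂ N]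
    (ρ : L →ₗ⁅ℂ⁆ Module.End ℂ M) (ρ' : L →ₗ⁅ℂ⁆ Module.End ℂ N) :
    L →ₗ⁅ℂ⁆ Module.End ℂ (M ⊗[ℂ] N) where
  toFun x := LinearMap.rTensor N (ρ x) + LinearMap.lTensor M (ρ' x)
  map_add' x y := by
    refine TensorProduct.ext' fun a b => ?_
    simp
    abel
  map_smul' r x := by
    refine TensorProduct.ext' fun a b => ?_
    simp [TensorProduct.smul_tmul']
  map_lie' := by
    intro x y
    refine TensorProduct.ext' fun a b => ?_
    simp [Ring.lie_def]
    abel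

theorem tensorRep_tmul {M N : Type*} [AddCommGroup M] [Module ℂ M] [AddCommGroup N] [Module ℂ N]
    (ρ : L →ₗ⁅ℂ⁆ Module.End ℂ M) (ρ' : L →ₗ⁅ℂ⁆ Module.End ℂ N) (x : L) (a : M) (b : N) :
    tensorRep ρ ρ' x (a ⊗ₜ b) = ρ x a ⊗ₜ b + a ⊗ₜ ρ' x b := rfl

/-- Contraction of the second tensor factor with a functional. -/
def contract (M : Type*) {N : Type*} [AddCommGroup M] [Module ℂ M] [AddCommGroup N] [Module ℂ N]
    (χ : N →ₗ[ℂ] ℂ) : M ⊗[ℂ] N →ₗ[ℂ] M :=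
  (TensorProduct.rid ℂ M).toLinearMap ∘ₗ LinearMap.lTensor M χ

theorem contract_tmul {M N : Type*} [AddCommGroup M] [Module ℂ M] [AddCommGroup N] [Module ℂ N]
    (χ : N →ₗ[ℂ] ℂ) (a : M) (b : N) : contract M χ (a ⊗ₜ b) = χ b • a := by
  simp [contract]

theorem contract_tensorRep {M N : Type*} [AddCommGroup M] [Module ℂ M] [AddCommGroup N]
    [Module ℂ N] (ρ : L →ₗ⁅ℂ⁆ Module.End ℂ M) (ρ' : L →ₗ⁅ℂ⁆ Module.End ℂ N) (χ : N →ₗ[ℂ] ℂ)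
    (x : L) (t : M ⊗[ℂ] N) :
    contract M χ (tensorRep ρ ρ' x t) = ρ x (contract M χ t) + contract M (χ ∘ₗ ρ' x) t := by
  induction t using TensorProduct.induction_on with
  | zero => simp
  | tmul a b => simp [tensorRep_tmul, contract_tmul]
  | add s t hs ht => simp only [map_add, hs, ht]; abel

end Enveloping

/-! ### Verma modules. -/

section Verma

variable (R) (lam : Module.Dual ℂ 𝔥)

theorem verma_lie (x : KMAlgebra R) (v : Verma R lam) :
    ⁅x, v⁆ = UniversalEnvelopingAlgebra.ι ℂ x • v := rfl

theorem mkQ_eq_smul_vermaVec (u : U R) :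
    (vermaIdeal R lam).mkQ u = (u • vermaVec R lam : Verma R lam) := by
  change _ = (vermaIdeal R lam).mkQ (u • 1)
  rw [smul_eq_mul, mul_one]

theorem exists_smul_vermaVec (v : Verma R lam) : ∃ u : U R, u • vermaVec R lam = v := by
  obtain ⟨u, hu⟩ := (vermaIdeal R lam).mkQ_surjective v
  exact ⟨u, (mkQ_eq_smul_vermaVec R lam u).symm.trans hu⟩

variable {R lam} in
theorem smul_vermaVec_eq_zero {u : U R} (hu : u ∈ vermaIdeal R lam) :
    u • vermaVec R lam = 0 :=
  (mkQ_eq_smul_vermaVec R lam u).symm.trans ((Submodule.Quotient.mk_eq_zero _).2 hu)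

theorem lie_e_vermaVec (i : I) : ⁅e R i, vermaVec R lam⁆ = 0 := by
  rw [verma_lie]
  exact smul_vermaVec_eq_zero (Submodule.subset_span (Or.inl ⟨i, rfl⟩))

theorem lie_h_vermaVec (x : 𝔥) : ⁅h R x, vermaVec R lam⁆ = lam x • vermaVec R lam := by
  rw [verma_lie, ← algebraMap_smul (U R) (lam x) (vermaVec R lam), ← sub_eq_zero, ← sub_smul]
  exact smul_vermaVec_eq_zero (Submodule.subset_span (Or.inr ⟨x, rfl⟩))

/-- The span of the words is stable under the generators of 𝔤, hence under 𝔤, hence under U(𝔤), and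
it contains the cyclic vector. -/
theorem verma_wordSpan : (kmAct R (Verma R lam)).wordSpan (vermaVec R lam) = ⊤ := by
  set W := (kmAct R (Verma R lam)).wordSpan (vermaVec R lam) with hW
  have hm : vermaVec R lam ∈ (kmAct R (Verma R lam)).wtSpace lam := lie_h_vermaVec R lam
  have hg : ∀ (x : KMAlgebra R), ∀ v ∈ W, ⁅x, v⁆ ∈ W := fun x v hv =>
    (generates_kmGen R).lie_mem
      (fun i v hv => Chevalley.e_mem_wordSpan hm (lie_e_vermaVec R lam) hv i)
      (fun i v hv => Chevalley.f_mem_wordSpan hv i)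
      (fun x v hv => Chevalley.h_mem_wordSpan hm hv x) x hv
  let S : Subalgebra ℂ (U R) :=
    { carrier := {u | ∀ v ∈ W, u • v ∈ W}
      mul_mem' := fun {a b} ha hb v hv => by
        rw [mul_smul]
        exact ha _ (hb v hv)
      add_mem' := fun {a b} ha hb v hv => by
        rw [add_smul]
        exact add_mem (ha v hv) (hb v hv)
      algebraMap_mem' := fun r v hv => by
        rw [algebraMap_smul]
        exact W.smul_mem r hv }
  have hS : S = ⊤ := enveloping_eq_top_of_ι_mem hg
  refine (Submodule.eq_top_iff').2 fun v => ?_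
  obtain ⟨u, rfl⟩ := exists_smul_vermaVec R lam v
  have hu : u ∈ S := hS ▸ Algebra.mem_top
  exact hu _ (Chevalley.self_mem_wordSpan _)

variable {R lam} {X : Type*} [AddCommGroup X] [Module ℂ X]

/-- The universal property of the Verma module. -/
theorem exists_verma_hom (σ : KMAlgebra R →ₗ⁅ℂ⁆ Module.End ℂ X) (x₀ : X)
    (he : ∀ i, σ (e R i) x₀ = 0) (hh : ∀ y, σ (h R y) x₀ = lam y • x₀) :
    ∃ Ψ : Verma R lam →ₗ[ℂ] X, Ψ (vermaVec R lam) = x₀ ∧ ∀ x v, Ψ ⁅x, v⁆ = σ x (Ψ v) := by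
  let F : U R →ₗ[ℂ] X :=
    (LinearMap.applyₗ x₀) ∘ₗ (UniversalEnvelopingAlgebra.lift ℂ σ).toLinearMap
  have hF : ∀ u, F u = UniversalEnvelopingAlgebra.lift ℂ σ u x₀ := fun _ => rfl
  have hker : (vermaIdeal R lam).restrictScalars ℂ ≤ LinearMap.ker F := by
    intro u hu
    rw [Submodule.restrictScalars_mem, vermaIdeal] at hu
    rw [LinearMap.mem_ker]
    induction hu using Submodule.span_induction with
    | mem u hu =>
      rcases hu with ⟨i, rfl⟩ | ⟨y, rfl⟩
      · simp only [hF]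
        rw [UniversalEnvelopingAlgebra.lift_ι_apply, he]
      · simp only [hF, map_sub, LinearMap.sub_apply]
        rw [UniversalEnvelopingAlgebra.lift_ι_apply, hh, AlgHom.commutes,
          Module.algebraMap_end_apply, sub_self]
    | zero => exact map_zero _
    | add u v _ _ hu hv => rw [map_add, hu, hv, add_zero]
    | smul a u _ hu => rw [hF, smul_eq_mul, map_mul, Module.End.mul_apply, ← hF u, hu, map_zero]
  let Ψ : Verma R lam →ₗ[ℂ] X := (((vermaIdeal R lam).restrictScalars ℂ).liftQ F hker) ∘ₗ
    (Submodule.Quotient.restrictScalarsEquiv ℂ (vermaIdeal R lam)).symm.toLinearMap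
  have hΨ : ∀ u : U R, Ψ (u • vermaVec R lam) = F u := fun u =>
    congrArg Ψ (mkQ_eq_smul_vermaVec R lam u).symm
  refine ⟨Ψ, ?_, fun x v => ?_⟩
  · rw [← one_smul (U R) (vermaVec R lam), hΨ, hF, map_one, Module.End.one_apply]
  · obtain ⟨u, rfl⟩ := exists_smul_vermaVec R lam v
    rw [verma_lie, ← mul_smul, hΨ, hΨ, hF, hF, map_mul, UniversalEnvelopingAlgebra.lift_ι_apply, Module.End.mul_apply]

end Verma

/-! ### Parabolic Verma modules and their submodules. -/

section Parabolic

variable (R) (lam : Module.Dual ℂ 𝔥) (J : Set I)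

/-- The highest weight vector of `M(λ, J)`. -/
def parVec : ParabolicVerma R lam J := LieSubmodule.Quotient.mk (vermaVec R lam)

theorem par_lie_mk (x : KMAlgebra R) (v : Verma R lam) :
    ⁅x, (LieSubmodule.Quotient.mk v : ParabolicVerma R lam J)⁆ = LieSubmodule.Quotient.mk ⁅x, v⁆ :=
  rfl

theorem lie_e_parVec (i : I) : ⁅e R i, parVec R lam J⁆ = 0 := by
  rw [parVec, par_lie_mk, lie_e_vermaVec]
  rfl

theorem parVec_mem_wtSpace :
    parVec R lam J ∈ (kmAct R (ParabolicVerma R lam J)).wtSpace lam := by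
  intro x
  rw [kmAct_h, parVec, par_lie_mk, lie_h_vermaVec]
  rfl

theorem par_wordSpan :
    (kmAct R (ParabolicVerma R lam J)).wordSpan (parVec R lam J) = ⊤ := by
  refine (Submodule.eq_top_iff').2 fun v => ?_
  obtain ⟨v, rfl⟩ := (integrabilitySubmodule R lam J).toSubmodule.mkQ_surjective v
  have : (kmAct R (Verma R lam)).wordSpan (vermaVec R lam) ≤
      ((kmAct R (ParabolicVerma R lam J)).wordSpan (parVec R lam J)).comap
        (integrabilitySubmodule R lam J).toSubmodule.mkQ :=
    Chevalley.wordSpan_le (Chevalley.self_mem_wordSpan _)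
      fun k v hv => Chevalley.f_mem_wordSpan hv k
  exact this (verma_wordSpan R lam ▸ Submodule.mem_top)

variable {R lam J}

theorem par_pow_f (j : I) (n : ℕ) (v : Verma R lam) :
    ((LieModule.toEnd ℂ (KMAlgebra R) (ParabolicVerma R lam J) (f R j)) ^ n)
      (LieSubmodule.Quotient.mk v) =
    LieSubmodule.Quotient.mk (((LieModule.toEnd ℂ (KMAlgebra R) (Verma R lam) (f R j)) ^ n) v) := by
  induction n with
  | zero => rfl
  | succ n ih =>
    rw [pow_succ', pow_succ', Module.End.mul_apply, ih]
    rfl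

theorem pow_f_parVec {j : I} (hj : j ∈ J) {n : ℕ} (hn : lam (R.coroot j) = n) :
    ((LieModule.toEnd ℂ (KMAlgebra R) (ParabolicVerma R lam J) (f R j)) ^ (n + 1))
      (parVec R lam J) = 0 := by
  rw [parVec, par_pow_f]
  exact (LieSubmodule.Quotient.mk_eq_zero').2 (LieSubmodule.subset_lieSpan ⟨j, hj, n, hn, rfl⟩)

/-- The universal property of `M(λ, J)`. -/
theorem exists_par_hom {X : Type*} [AddCommGroup X] [Module ℂ X]
    (σ : KMAlgebra R →ₗ⁅ℂ⁆ Module.End ℂ X) (x₀ : X)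
    (he : ∀ i, σ (e R i) x₀ = 0) (hh : ∀ y, σ (h R y) x₀ = lam y • x₀)
    (hf : ∀ j ∈ J, ∀ n : ℕ, lam (R.coroot j) = n → ((σ (f R j)) ^ (n + 1)) x₀ = 0) :
    ∃ Ψ : ParabolicVerma R lam J →ₗ[ℂ] X, Ψ (parVec R lam J) = x₀ ∧
      ∀ x v, Ψ ⁅x, v⁆ = σ x (Ψ v) := by
  obtain ⟨Ψ, h0, hΨ⟩ := exists_verma_hom σ x₀ he hh
  let K : LieSubmodule ℂ (KMAlgebra R) (Verma R lam) :=
    { LinearMap.ker Ψ with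
      lie_mem := fun {x v} hv => by
        have hv : Ψ v = 0 := hv
        change Ψ ⁅x, v⁆ = 0
        rw [hΨ, hv, map_zero] }
  have hpow : ∀ x n v, Ψ (((LieModule.toEnd ℂ (KMAlgebra R) (Verma R lam) x) ^ n) v) =
      ((σ x) ^ n) (Ψ v) := by
    intro x n v
    induction n with
    | zero => rfl
    | succ n ih =>
      rw [pow_succ', pow_succ', Module.End.mul_apply, Module.End.mul_apply, ← ih,
        LieModule.toEnd_apply_apply, hΨ]
  have hK : integrabilitySubmodule R lam J ≤ K := by
    refine LieSubmodule.lieSpan_le.2 ?_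
    rintro _ ⟨j, hj, n, hn, rfl⟩
    change Ψ _ = 0
    rw [hpow, h0, hf j hj n hn]
  refine ⟨(integrabilitySubmodule R lam J).toSubmodule.liftQ Ψ hK, h0, fun x v => ?_⟩
  obtain ⟨v, rfl⟩ := (integrabilitySubmodule R lam J).toSubmodule.mkQ_surjective v
  exact hΨ x v

/-- For `i ∉ J`, the module `M(λ, J)` has an operator behaving like the partial derivative with
respect to `f_i`. -/
theorem exists_derivative (hA : IsGCM A) {i : I} (hi : i ∉ J) :
    ∃ D : Module.End ℂ (ParabolicVerma R lam J), D (parVec R lam J) = 0 ∧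
      (∀ v, D ⁅f R i, v⁆ = ⁅f R i, D v⁆ + v) ∧ ∀ k, k ≠ i → ∀ v, D ⁅f R k, v⁆ = ⁅f R k, D v⁆ := by
  let M := ParabolicVerma R lam J
  have ht := isTester R 0 i
  let ρ := LieModule.toEnd ℂ (KMAlgebra R) M
  let σ := tensorRep ρ (kmTester R i hA)
  have hσ : ∀ x a b, σ x (a ⊗ₜ b) = ⁅x, a⁆ ⊗ₜ b + a ⊗ₜ kmTester R i hA x b := fun _ _ _ => rfl
  -- The vector m ⊗ n has weight λ + 0. For j ∈ J one has j ≠ i, so f_j kills n and f_j^r (m ⊗ n) =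
  -- f_j^r m ⊗ n; thus the relations of M(λ, J) carry over.
  obtain ⟨Δ, hΔ0, hΔ⟩ := exists_par_hom (lam := lam) (J := J) σ
    (parVec R lam J ⊗ₜ testerVec R 0 i) (fun k => by
      rw [hσ, lie_e_parVec, kmTester_e, ht.e_apply, TensorProduct.zero_tmul,
        TensorProduct.tmul_zero, add_zero]) (fun y => by
      have h1 := parVec_mem_wtSpace R lam J y
      have h2 := ht.mem_wtSpace y
      simp only [kmAct_h, LinearMap.zero_apply, zero_smul] at h1 h2
      rw [hσ, h1, kmTester_h, h2, TensorProduct.tmul_zero, add_zero, TensorProduct.smul_tmul'])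
    (fun j hj n hn => by
      have hji : j ≠ i := fun h => hi (h ▸ hj)
      have : ∀ m : ℕ, ((σ (f R j)) ^ m) (parVec R lam J ⊗ₜ testerVec R 0 i) =
          ((ρ (f R j)) ^ m) (parVec R lam J) ⊗ₜ testerVec R 0 i := by
        intro m
        induction m with
        | zero => rfl
        | succ m ih =>
          rw [pow_succ', pow_succ', Module.End.mul_apply, Module.End.mul_apply, ih, hσ, kmTester_f,
            tester_f_testerVec R i hji, TensorProduct.tmul_zero, add_zero]
          rfl
      rw [this, pow_f_parVec hj hn, TensorProduct.zero_tmul])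
  let E : Module.End ℂ M := contract M (testerφ R 0 i) ∘ₗ Δ
  let D : Module.End ℂ M := contract M (testerψ R 0 i) ∘ₗ Δ
  have hEf : ∀ k v, E ⁅f R k, v⁆ = ⁅f R k, E v⁆ := by
    intro k v
    have h0 : testerφ R 0 i ∘ₗ kmTester R i hA (f R k) = 0 := by
      refine LinearMap.ext fun v => ?_
      rw [LinearMap.comp_apply, kmTester_f]
      exact ht.φ_f k v
    change contract M _ (Δ _) = _
    rw [hΔ, contract_tensorRep, h0]
    simp [contract, ρ, E]
  -- The n-coefficient of Δ fixes m and commutes with every f_k, so it is the identity. It is the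
  -- term v in the rule for D f_i.
  have hE : ∀ v, E v = v := by
    have : (⊤ : Submodule ℂ M) ≤ LinearMap.eqLocus E LinearMap.id := by
      rw [← par_wordSpan]
      refine Chevalley.wordSpan_le ?_ fun k v hv => ?_
      · change contract M _ (Δ _) = _
        rw [hΔ0, contract_tmul, ht.φ_self, one_smul]
        rfl
      · have hv : E v = v := hv
        change E ⁅f R k, v⁆ = ⁅f R k, v⁆
        rw [hEf, hv]
    exact fun v => this Submodule.mem_top
  refine ⟨D, ?_, fun v => ?_, fun k hk v => ?_⟩
  · change contract M _ (Δ _) = _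
    rw [hΔ0, contract_tmul, ht.ψ_self, zero_smul]
  · have h0 : testerψ R 0 i ∘ₗ kmTester R i hA (f R i) = testerφ R 0 i := by
      refine LinearMap.ext fun v => ?_
      rw [LinearMap.comp_apply, kmTester_f]
      exact ht.ψ_f v
    change contract M _ (Δ _) = _
    rw [hΔ, contract_tensorRep, h0]
    exact congrArg _ (hE v)
  · have h0 : testerψ R 0 i ∘ₗ kmTester R i hA (f R k) = 0 := by
      refine LinearMap.ext fun v => ?_
      rw [LinearMap.comp_apply, kmTester_f]
      exact ht.ψ_f_ne k v hk
    change contract M _ (Δ _) = _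
    rw [hΔ, contract_tensorRep, h0]
    simp [contract, ρ, D]

/-- For `i ∉ J`, the action of `f_i` on `M(λ, J)` is injective. -/
theorem eq_zero_of_lie_f_eq_zero (hA : IsGCM A) {i : I} (hi : i ∉ J)
    {v : ParabolicVerma R lam J} (hv : ⁅f R i, v⁆ = 0) : v = 0 := by
  classical
  obtain ⟨D, hD0, hDi, hDk⟩ := exists_derivative (R := R) (lam := lam) hA hi
  -- From [D, f_i] = 1. If f_i v = 0 and n + 1 is the least exponent with D^(n+1) v = 0, this leaves
  -- (n + 1) D^n v = 0, which is impossible.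
  have hpow : ∀ (n : ℕ) v, (D ^ (n + 1)) ⁅f R i, v⁆ =
      ⁅f R i, (D ^ (n + 1)) v⁆ + ((n : ℂ) + 1) • (D ^ n) v := by
    intro n
    induction n with
    | zero => simp [hDi]
    | succ n ih =>
      intro v
      rw [pow_succ', Module.End.mul_apply, ih, map_add, hDi, map_smul,
        ← Module.End.mul_apply, ← Module.End.mul_apply, ← pow_succ', ← pow_succ', add_assoc]
      congr 1
      nth_rewrite 1 [← one_smul ℂ ((D ^ (n + 1)) v)]
      rw [← add_smul]
      congr 1
      push_cast
      ring
  let W : Submodule ℂ (ParabolicVerma R lam J) :=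
    { carrier := {v | ∃ n, (D ^ n) v = 0}
      zero_mem' := ⟨0, by simp⟩
      add_mem' := exists_pow_add_eq_zero
      smul_mem' := by
        rintro r v ⟨n, hn⟩
        exact ⟨n, by rw [map_smul, hn, smul_zero]⟩ }
  have hW : (⊤ : Submodule ℂ (ParabolicVerma R lam J)) ≤ W := by
    rw [← par_wordSpan]
    refine Chevalley.wordSpan_le ⟨1, by simpa using hD0⟩ ?_
    rintro k v ⟨n, hn⟩
    by_cases hk : k = i
    · subst hk
      refine ⟨n + 1, ?_⟩
      rw [kmAct_f, hpow, hn, smul_zero, add_zero, pow_succ', Module.End.mul_apply, hn, map_zero,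
        lie_zero]
    · refine ⟨n, ?_⟩
      have : ∀ m, (D ^ m) ⁅f R k, v⁆ = ⁅f R k, (D ^ m) v⁆ := by
        intro m
        induction m with
        | zero => rfl
        | succ m ih =>
          rw [pow_succ', Module.End.mul_apply, ih, hDk k hk, Module.End.mul_apply]
      rw [kmAct_f, this, hn, lie_zero]
  have hex : ∃ n, (D ^ n) v = 0 := hW Submodule.mem_top
  have h1 := Nat.find_spec hex
  rcases h : Nat.find hex with _ | n
  · rw [h] at h1
    exact h1
  · have h2 : (D ^ n) v ≠ 0 := Nat.find_min hex (by omega)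
    rw [h] at h1
    have h3 := hpow n v
    rw [hv, h1, map_zero, lie_zero, zero_add, eq_comm, smul_eq_zero, or_iff_left h2] at h3
    exact absurd h3 (Nat.cast_add_one_ne_zero n)

theorem par_exists_pow_f (hJ : J ⊆ Jset R lam) {j : I} (hj : j ∈ J)
    (v : ParabolicVerma R lam J) :
    ∃ n, ((LieModule.toEnd ℂ (KMAlgebra R) (ParabolicVerma R lam J) (f R j)) ^ n) v = 0 := by
  have : (⊤ : Submodule ℂ (ParabolicVerma R lam J)) ≤
      (nilSubmodule (M := ParabolicVerma R lam J) (f R j) (exists_pow_ad_f R j)).toSubmodule := by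
    rw [← par_wordSpan]
    obtain ⟨n, hn⟩ := hJ hj
    exact Chevalley.wordSpan_le ⟨n + 1, pow_f_parVec hj hn⟩
      fun k v hv => LieSubmodule.lie_mem _ hv
  exact this Submodule.mem_top

theorem par_exists_pow_e (j : I) (v : ParabolicVerma R lam J) :
    ∃ n, ((LieModule.toEnd ℂ (KMAlgebra R) (ParabolicVerma R lam J) (e R j)) ^ n) v = 0 := by
  have : (⊤ : Submodule ℂ (ParabolicVerma R lam J)) ≤
      (nilSubmodule (M := ParabolicVerma R lam J) (e R j) (exists_pow_ad_e R j)).toSubmodule := by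
    rw [← par_wordSpan]
    refine Chevalley.wordSpan_le ⟨1, ?_⟩ fun k v hv => LieSubmodule.lie_mem _ hv
    rw [pow_one]
    exact lie_e_parVec R lam J j
  exact this Submodule.mem_top

theorem par_exists_word {μ : Module.Dual ℂ 𝔥} {v : ParabolicVerma R lam J}
    (hv : v ∈ (kmAct R (ParabolicVerma R lam J)).wtSpace μ) (hv0 : v ≠ 0) :
    ∃ w, lam - rt R (cnt w) = μ ∧
      (kmAct R (ParabolicVerma R lam J)).word w (parVec R lam J) ≠ 0 := by
  obtain ⟨w, hw, hw0⟩ := exists_of_span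
    (fun w => Chevalley.word_mem_wtSpace (parVec_mem_wtSpace R lam J) w) hv hv0
    (by
      change v ∈ (kmAct R (ParabolicVerma R lam J)).wordSpan (parVec R lam J)
      rw [par_wordSpan]
      trivial)
  exact ⟨w, by rw [← wordWt_eq_rt, hw], hw0⟩

/-- The letter of Z closest to m commutes past the remaining letters, all outside Z, and then kills
m. -/
theorem Chevalley.word_eq_zero {V : Type*} [AddCommGroup V] [Module ℂ V]
    {c : Chevalley R (Module.End ℂ V)} {Z : Set I} {m : V} (hm : ∀ z ∈ Z, c.f z m = 0)
    {w : List I} (hZ : ∀ z ∈ Z, ∀ k ∉ Z, k ∈ w → ∀ v, c.f z (c.f k v) = c.f k (c.f z v))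
    (hw : ∃ z ∈ w, z ∈ Z) : c.word w m = 0 := by
  induction w with
  | nil => simp at hw
  | cons k w ih =>
    rw [Chevalley.word_cons]
    by_cases h : ∃ z ∈ w, z ∈ Z
    · rw [ih (fun z hz k hk hkw => hZ z hz k hk (by simp [hkw])) h, map_zero]
    · have hk : k ∈ Z := by
        obtain ⟨z, hz, hzZ⟩ := hw
        rcases List.mem_cons.1 hz with rfl | hz
        · exact hzZ
        · exact absurd ⟨z, hz, hzZ⟩ h
      have : ∀ u : List I, (∀ l ∈ u, l ∈ w) → c.f k (c.word u m) = 0 := by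
        intro u
        induction u with
        | nil => exact fun _ => hm k hk
        | cons l u ihu =>
          intro hu
          have hl : l ∈ w := hu l (by simp)
          rw [Chevalley.word_cons, hZ k hk l (fun hlZ => h ⟨l, hl, hlZ⟩) (by simp [hl]),
            ihu fun l' hl' => hu l' (by simp [hl']), map_zero]
      exact this w fun _ hl => hl

theorem mem_wt_submodule_iff {M : Type*} [AddCommGroup M] [Module ℂ M]
    [LieRingModule (KMAlgebra R) M] [LieModule ℂ (KMAlgebra R) M]
    {V : LieSubmodule ℂ (KMAlgebra R) M} {μ : Module.Dual ℂ 𝔥} :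
    μ ∈ wt R V ↔ ∃ v ∈ V, v ∈ (kmAct R M).wtSpace μ ∧ v ≠ 0 := by
  rw [mem_wt_iff]
  constructor
  · rintro ⟨v, hv, hv0⟩
    exact ⟨v, v.2, fun x => congrArg Subtype.val (hv x), by simpa using hv0⟩
  · rintro ⟨v, hvV, hv, hv0⟩
    exact ⟨⟨v, hvV⟩, fun x => Subtype.ext (hv x), by simpa using hv0⟩

/-- Of V only stability under e_i and f_i is used, so that e_i v₀ and f_i v vanish when there is no
step; the contradiction then takes place in M(λ, J). -/
theorem hasStep_submodule (hA : IsGCM A) (hJ : J ⊆ Jset R lam)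
    (V : LieSubmodule ℂ (KMAlgebra R) (ParabolicVerma R lam J)) : HasStep R (wt R V) := by
  intro μ₀ hμ₀ c hc hc0 hμ
  by_contra! hstuck
  obtain ⟨v₀, hv₀V, hv₀, hv₀0⟩ := mem_wt_submodule_iff.1 hμ₀
  obtain ⟨v, hvV, hv, hv0⟩ := mem_wt_submodule_iff.1 hμ
  have he : ∀ i, 0 < c i → ⁅e R i, v₀⁆ = 0 := by
    intro i hi
    by_contra h0
    exact (hstuck i hi).1 (mem_wt_submodule_iff.2
      ⟨_, V.lie_mem hv₀V, Chevalley.e_mem_wtSpace hv₀ i, h0⟩)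
  have hf : ∀ i, 0 < c i → ⁅f R i, v⁆ = 0 := by
    intro i hi
    by_contra h0
    exact (hstuck i hi).2 (mem_wt_submodule_iff.2
      ⟨_, V.lie_mem hvV, Chevalley.f_mem_wtSpace hv i, h0⟩)
  have hcJ : ∀ i, 0 < c i → i ∈ J := by
    intro i hi
    by_contra hiJ
    exact hv0 (eq_zero_of_lie_f_eq_zero hA hiJ (hf i hi))
  -- The integers λ(α_i^∨), with the dummy value 0 outside J; they are only consulted on supp c ⊆ J.
  have hl : ∀ i, ∃ n : ℕ, i ∈ J → lam (R.coroot i) = n := by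
    intro i
    by_cases hi : i ∈ J
    · obtain ⟨n, hn⟩ := hJ hi
      exact ⟨n, fun _ => hn⟩
    · exact ⟨0, fun h => absurd h hi⟩
  choose l hl using hl
  obtain ⟨w, hw, -⟩ := par_exists_word hv hv0
  obtain ⟨w₀, hw₀, hw₀0⟩ := par_exists_word hv₀ hv₀0
  have hcnt : cnt w₀ = cnt w + c := by
    rw [← (rt_injective (R := R)).eq_iff, map_add]
    have h1 : lam - rt R (cnt w) = lam - rt R (cnt w₀) + rt R c := by rw [hw, hw₀]
    rw [sub_add] at h1
    have h2 := sub_right_injective h1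
    rw [h2, sub_add_cancel]
  have h1 : ∀ i, 0 < c i → ∃ n : ℕ, (l i : ℤ) - ∑ j, A i j * cnt w₀ j = n := by
    intro i hi
    obtain ⟨n, hn⟩ := Chevalley.exists_nat_of_pow_f_eq_zero hA hv₀0 (hv₀ (R.coroot i))
      (he i hi) (par_exists_pow_f hJ (hcJ i hi) v₀)
    rw [← hw₀, LinearMap.sub_apply, rt_apply_coroot, hl i (hcJ i hi)] at hn
    exact ⟨n, by exact_mod_cast hn⟩
  have h2 : ∀ i, 0 < c i → ∃ n : ℕ, (l i : ℤ) - ∑ j, A i j * cnt w j = -n := by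
    intro i hi
    obtain ⟨n, hn⟩ := Chevalley.exists_nat_of_pow_e_eq_zero hA hv0 (hv (R.coroot i))
      (hf i hi) (par_exists_pow_e i v)
    rw [← hw, LinearMap.sub_apply, rt_apply_coroot, hl i (hcJ i hi)] at hn
    exact ⟨n, by exact_mod_cast hn⟩
  -- With d the coefficients of λ - μ, the 𝔰𝔩₂ inequalities read l - A(d + c) ≥ 0 ≥ l - Ad on supp
  -- c; hence l ≤ Ad and Ac ≤ 0 there.
  obtain ⟨Z, ⟨z, hz⟩, hZc, hZ⟩ := hA.exists_orthogonal_subset (c := c) (d := cnt w)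
    (l := fun i => (l i : ℤ)) hc (cnt_nonneg w) hc0
    (fun i hi => by
      obtain ⟨n, hn⟩ := h1 i hi
      obtain ⟨n', hn'⟩ := h2 i hi
      simp only [hcnt, Pi.add_apply, mul_add, Finset.sum_add_distrib] at hn
      omega)
    (fun i hi => by
      obtain ⟨n, hn⟩ := h2 i hi
      omega)
    (fun i _ => Int.natCast_nonneg _)
  -- The word `w₀` of weight λ - μ₀ contains every letter of Z. On Z, l = 0 turns the integrability
  -- relation into f_y m = 0, and orthogonality with the Serre relation gives commutation with the
  -- other letters.
  refine hw₀0 (Chevalley.word_eq_zero (Z := Z) (fun y hy => ?_) (fun y hy k hk hkw v => ?_)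
    ⟨z, ?_, hz⟩)
  · have hyJ := hcJ y (hZc y hy).1
    have hly : l y = 0 := by exact_mod_cast (hZc y hy).2
    have := pow_f_parVec hyJ (hl y hyJ)
    rw [hly, zero_add, pow_one] at this
    exact this
  · have hk0 : 0 < cnt w k + c k := by
      rw [← Pi.add_apply, ← hcnt]
      exact cnt_pos_iff.2 hkw
    have h0 : ⁅f R y, f R k⁆ = 0 :=
      Chevalley.lie_f_f_eq_zero (c := kmGen R) (fun _ _ => kmGen_serre R)
        (by rintro rfl; exact hk hy) (hZ y hy k hk hk0)
    rw [kmAct_f, kmAct_f, kmAct_f, kmAct_f, leibniz_lie, h0, zero_lie, zero_add]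
  · rw [← cnt_pos_iff, hcnt, Pi.add_apply]
    have := (hZc z hz).1
    have := cnt_nonneg w z
    omega

end Parabolic

end KacMoody

end

theorem theoremD {I : Type*} [Fintype I] (A : Matrix I I ℤ) (hA : KacMoody.IsGCM A)
    {𝔥 : Type*} [AddCommGroup 𝔥] [Module ℂ 𝔥] (R : KacMoody.Realization A 𝔥) :
    (∀ μ₀ ∈ KacMoody.wt R (KacMoody.KMAlgebra R), ∀ μ ∈ KacMoody.wt R (KacMoody.KMAlgebra R),
      KacMoody.Prec R μ₀ μ → μ₀ ≠ μ →
        KacMoody.HasSimpleChain R (KacMoody.wt R (KacMoody.KMAlgebra R)) μ₀ μ) ∧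
    (∀ (lam : Module.Dual ℂ 𝔥) (J : Set I), J ⊆ KacMoody.Jset R lam →
      ∀ V : LieSubmodule ℂ (KacMoody.KMAlgebra R) (KacMoody.ParabolicVerma R lam J),
        ∀ μ₀ ∈ KacMoody.wt R V, ∀ μ ∈ KacMoody.wt R V,
          KacMoody.Prec R μ₀ μ → μ₀ ≠ μ →
            KacMoody.HasSimpleChain R (KacMoody.wt R V) μ₀ μ) :=
  ⟨fun _ hμ₀ _ hμ h _ => (KacMoody.hasStep_adjoint hA).hasSimpleChain hμ₀ hμ h,
    fun _ _ hJ V _ hμ₀ _ hμ h _ =>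
      (KacMoody.hasStep_submodule hA hJ V).hasSimpleChain hμ₀ hμ h⟩
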